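/- Let $I,J\ge 1$, let the temperatures $w_1,\dots,w_I\in\mathbb{R}$ not be all equal, let the inspection times satisfy $t_1,\dots,t_J>0$, and let $\Theta=(0,\infty)\times\mathbb{R}$. For $\boldsymbol{\alpha}=(\alpha_0,\alpha_1)^T\in\Theta$ put $\lambda_i(\boldsymbol{\alpha})=\alpha_0 e^{\alpha_1 w_i}$, $F_{ij}(\boldsymbol{\alpha})=1-e^{-\lambda_i(\boldsymbol{\alpha})t_j}$ and $f_{ij}(\boldsymbol{\alpha})=\lambda_i(\boldsymbol{\alpha})e^{-\lambda_i(\boldsymbol{\alpha})t_j}$. Let $y_{ijk}$ ($1\le i\le I$, $1\le j\le J$, $k=1,2,\dots$) be independent Bernoulli random variables with $P(y_{ijk}=1)=F_{ij}(\boldsymbol{\alpha}^*)$, where $\boldsymbol{\alpha}^*\in\Theta$ is the true parameter, and let $n_{ij}=\sum_{k=1}^K y_{ijk}$. For $\beta\ge 0$ the minimum density power divergence estimator (MDPDE) $\widehat{\boldsymbol{\alpha}}_\beta=\widehat{\boldsymbol{\alpha}}_{\beta,K}$ is a random vector which is a minimizer over $\boldsymbol{\alpha}\in\Theta$, whenever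 there is one, of $$\frac{1}{IJK}\sum_{i=1}^I\sum_{j=1}^J\sum_{k=1}^K\Big\{F_{ij}^{\beta+1}(\boldsymbol{\alpha})+(1-F_{ij}(\boldsymbol{\alpha}))^{\beta+1}-\tfrac{1+\beta}{\beta}\big(F_{ij}^{y_{ijk}}(\boldsymbol{\alpha})(1-F_{ij}(\boldsymbol{\alpha}))^{1-y_{ijk}}\big)^{\beta}\Big\}$$ if $\beta>0$, and of the Kullback-Leibler divergence $$\frac{1}{IJ}\sum_{i=1}^I\sum_{j=1}^J\Big\{\tfrac{n_{ij}}{K}\log\tfrac{n_{ij}}{KF_{ij}(\boldsymbol{\alpha})}+\tfrac{K-n_{ij}}{K}\log\tfrac{K-n_{ij}}{K(1-F_{ij}(\boldsymbol{\alpha}))}\Big\}$$ (with $0\log 0=0$) if $\beta=0$; where no minimizer exists its value is arbitrary. Let $$\boldsymbol{\bar J}_\beta(\boldsymbol{\alpha})=\sum_{i=1}^I\begin{pmatrix}\frac1{\alpha_0^2}&\frac{w_i}{\alpha_0}\\ \frac{w_i}{\alpha_0}&w_i^2\end{pmatrix}\sum_{j=1}^J t_j^2f_{ij}^2(\boldsymbol{\alpha})\big[F_{ij}^{\beta-1}(\boldsymbol{\alpha})+(1-F_{ij}(\boldsymbol{\alpha}))^{\beta-1}\big],$$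 $$\boldsymbol{\bar K}_\beta(\boldsymbol{\alpha})=\sum_{i=1}^I\begin{pmatrix}\frac1{\alpha_0^2}&\frac{w_i}{\alpha_0}\\ \frac{w_i}{\alpha_0}&w_i^2\end{pmatrix}\sum_{j=1}^J t_j^2f_{ij}^2(\boldsymbol{\alpha})\Big\{F_{ij}^{2\beta-1}(\boldsymbol{\alpha})+(1-F_{ij}(\boldsymbol{\alpha}))^{2\beta-1}-\big[F_{ij}^{\beta}(\boldsymbol{\alpha})-(1-F_{ij}(\boldsymbol{\alpha}))^{\beta}\big]^2\Big\}.$$ Then, for every $\beta\ge0$, every $\boldsymbol{m}\in\mathbb{R}^2\setminus\{\boldsymbol 0\}$ and $d\in\mathbb{R}$, under the null hypothesis $H_0:\boldsymbol{m}^T\boldsymbol{\alpha}^*=d$, the $Z$-type test statistic $$Z_K(\widehat{\boldsymbol{\alpha}}_\beta)=\sqrt{\frac{K}{\boldsymbol{m}^T\boldsymbol{\bar J}_\beta^{-1}(\widehat{\boldsymbol{\alpha}}_\beta)\boldsymbol{\bar K}_\beta(\widehat{\boldsymbol{\alpha}}_\beta)\boldsymbol{\bar J}_\beta^{-1}(\widehat{\boldsymbol{\alpha}}_\beta)\boldsymbol{m}}}\;(\boldsymbol{m}^T\widehat{\boldsymbol{\alpha}}_\beta-d)$$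 converges in law to the standard normal distribution as $K\to\infty$ with $I,J$ fixed. -/

import Mathlib

open MeasureTheory ProbabilityTheory Filter

namespace OneShot

noncomputable section

/-- The parameter space `Θ = (0, ∞) × ℝ` of `α = (α₀, α₁)`. -/
def Theta : Set (Fin 2 → ℝ) := {α | 0 < α 0}

/-- The failure rate `λ_w(α) = α₀ exp(α₁ w)` at temperature `w`. -/
def rate (w : ℝ) (α : Fin 2 → ℝ) : ℝ := α 0 * Real.exp (α 1 * w)

/-- The exponential distribution function at time `t`, `F(t | λ_w(α)) = 1 - exp(-λ_w(α) t)`; this is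
the probability `π(α)` that a device tested at temperature `w` and time `t` is a failure. -/
def failProb (w t : ℝ) (α : Fin 2 → ℝ) : ℝ := 1 - Real.exp (-(rate w α * t))

/-- The exponential density at time `t`, `f(t | λ_w(α)) = λ_w(α) exp(-λ_w(α) t)`. -/
def dens (w t : ℝ) (α : Fin 2 → ℝ) : ℝ := rate w α * Real.exp (-(rate w α * t))

/-- The failure probability is a number of `[0, 1]`. -/
theorem failProb_mem {w t : ℝ} {α : Fin 2 → ℝ} (hα : α ∈ Theta) (ht : 0 < t) :
    failProb w t α ∈ unitInterval := by
  have h0 : 0 < α 0 := hα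
  have h : 0 ≤ rate w α * t := by unfold rate; positivity
  have h1 : Real.exp (-(rate w α * t)) ≤ 1 := Real.exp_le_one_iff.mpr (by linarith)
  have h2 := Real.exp_pos (-(rate w α * t))
  unfold failProb
  constructor <;> linarith

/-- The summand `V_ij(y, β)`, for `β > 0`, of the density power divergence objective, at a cell with
temperature `w` and inspection time `t`, for the outcome `y ∈ {0, 1}` (`y = 1` is a failure). -/
def V (β w t : ℝ) (y : ℕ) (α : Fin 2 → ℝ) : ℝ :=
  failProb w t α ^ (β + 1) + (1 - failProb w t α) ^ (β + 1)
    - (1 + β) / β * (failProb w t α ^ y * (1 - failProb w t α) ^ (1 - y)) ^ β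

variable {I J : ℕ}

/-- The number of failures `n_ij` among the first `K` devices of the cell `(i, j)`. -/
def failures (y : Fin I → Fin J → ℕ → ℕ) (K : ℕ) (i : Fin I) (j : Fin J) : ℕ :=
  ∑ k ∈ Finset.range K, y i j k

/-- The Kullback-Leibler divergence between the observed probability vector `p̂` and the theoretical
probability vector `p(α)`, with the usual `0 log 0 = 0`. -/
def dKL (w : Fin I → ℝ) (t : Fin J → ℝ) (K : ℕ) (y : Fin I → Fin J → ℕ → ℕ)
    (α : Fin 2 → ℝ) : ℝ :=
  1 / ((I : ℝ) * J) * ∑ i, ∑ j,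
    ((failures y K i j : ℝ) / K
        * Real.log ((failures y K i j : ℝ) / (K * failProb (w i) (t j) α))
      + ((K : ℝ) - failures y K i j) / K
        * Real.log (((K : ℝ) - failures y K i j) / (K * (1 - failProb (w i) (t j) α))))

/-- The function of `α` that the minimum density power divergence estimator with tuning parameter
`β ≥ 0` minimizes. For `β = 0` it is the Kullback-Leibler divergence, and the estimator is the
maximum likelihood estimator. -/
def objective (β : ℝ) (w : Fin I → ℝ) (t : Fin J → ℝ) (K : ℕ) (y : Fin I → Fin J → ℕ → ℕ)
    (α : Fin 2 → ℝ) : ℝ :=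
  if β = 0 then dKL w t K y α
  else 1 / ((I : ℝ) * J * K) * ∑ i, ∑ j, ∑ k ∈ Finset.range K, V β (w i) (t j) (y i j k) α

/-- `a` is a minimum density power divergence estimate for the data `y i j k`, `k < K`:
`a ∈ argmin_{α ∈ Θ} objective α`. -/
def IsMDPDE (β : ℝ) (w : Fin I → ℝ) (t : Fin J → ℝ) (K : ℕ) (y : Fin I → Fin J → ℕ → ℕ)
    (a : Fin 2 → ℝ) : Prop :=
  a ∈ Theta ∧ ∀ α ∈ Theta, objective β w t K y a ≤ objective β w t K y α

/-- The matrix `[[1/α₀², w/α₀], [w/α₀, w²]]`. -/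
def W (w : ℝ) (α : Fin 2 → ℝ) : Matrix (Fin 2) (Fin 2) ℝ :=
  !![1 / α 0 ^ 2, w / α 0; w / α 0, w ^ 2]

/-- The matrix `J̄_β(α)`. -/
def Jbar (β : ℝ) (w : Fin I → ℝ) (t : Fin J → ℝ) (α : Fin 2 → ℝ) : Matrix (Fin 2) (Fin 2) ℝ :=
  ∑ i, (∑ j, t j ^ 2 * dens (w i) (t j) α ^ 2
    * (failProb (w i) (t j) α ^ (β - 1) + (1 - failProb (w i) (t j) α) ^ (β - 1))) • W (w i) α

/-- The matrix `K̄_β(α)`. -/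
def Kbar (β : ℝ) (w : Fin I → ℝ) (t : Fin J → ℝ) (α : Fin 2 → ℝ) : Matrix (Fin 2) (Fin 2) ℝ :=
  ∑ i, (∑ j, t j ^ 2 * dens (w i) (t j) α ^ 2
    * ((failProb (w i) (t j) α ^ (2 * β - 1) + (1 - failProb (w i) (t j) α) ^ (2 * β - 1))
      - (failProb (w i) (t j) α ^ β - (1 - failProb (w i) (t j) α) ^ β) ^ 2)) • W (w i) α

/-- The `Z`-type test statistic for `H₀ : mᵀ α = d`, as a function of the number `K` of devices per
cell and of the estimate `a`. -/
def Z (β : ℝ) (w : Fin I → ℝ) (t : Fin J → ℝ) (m : Fin 2 → ℝ) (d : ℝ) (K : ℕ)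
    (a : Fin 2 → ℝ) : ℝ :=
  Real.sqrt ((K : ℝ) / (m ⬝ᵥ
      (((Jbar β w t a)⁻¹ * Kbar β w t a * (Jbar β w t a)⁻¹).mulVec m)))
    * (m ⬝ᵥ a - d)

end

end OneShot

/-! ### Bernoulli sequences, Slutsky arguments and the central limit theorem. -/

section Prob

open scoped Topology

variable {Ω : Type*} [MeasurableSpace Ω] {P : Measure Ω}

/-! The data enter the objective only through the relative frequencies `x c` of failure in the cells
`c = (i, j)`: up to a positive factor it is the sum over the cells of `cellObj β (x c) (p c)`, where
`p c` is the failure probability at the parameter (`objective_eq`).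

Consistency. In each cell the excess of `cellObj β x p` over `cellObj β x x` dominates a gap,
continuous up to the boundary, that vanishes only at `p = x`: a Bregman divergence for `β > 0`, a
squared Hellinger-type distance for `β = 0`. Two distinct temperatures at a common inspection time
determine the parameter continuously. Hence frequencies near the true probabilities make every
parameter far from the truth worse than the truth (`eventually_freqObj_lt`). By the strong law,
almost surely a minimizer eventually exists and the estimator converges.

Linearization. A minimizer is interior to `Theta`, so it solves `∑ c, (p c - x c) • score c = 0`.
Inverting the linear part, whose matrix is `Jbar`, gives pathwise `α̂ - α = Jbar⁻¹ ∑ c, (x c - p c)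
• score c + o(∑ c, |x c - p c|)` (`isLittleO_of_estimatingEquation`).

Limit law. After multiplication by `√K` the linear term obeys the central limit theorem. Its
variance is the sandwich `mᵀ Jbar⁻¹ Kbar Jbar⁻¹ m`, thanks to the identity `weight_sq_mul`. The
remainder tends to zero in probability because each `√K (x c - p c)` converges in law. Slutsky's
theorem and continuity of the variance at the truth finish the proof. -/

theorem hasLaw_bernoulli_cast {y : Ω → ℕ} {p : unitInterval}
    (h : HasLaw y (bernoulliMeasure 1 0 p) P) :
    HasLaw (fun ω => (y ω : ℝ)) (bernoulliMeasure 1 0 p) P := by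
  have : HasLaw (fun n : ℕ => (n : ℝ)) (bernoulliMeasure (1 : ℝ) 0 p)
      (bernoulliMeasure (1 : ℕ) 0 p) := ⟨by fun_prop, by simp⟩
  exact this.comp h

theorem ae_eq_zero_or_one_of_hasLaw_bernoulli {y : Ω → ℕ} {p : unitInterval}
    (h : HasLaw y (bernoulliMeasure 1 0 p) P) : ∀ᵐ ω ∂P, y ω = 0 ∨ y ω = 1 := by
  rw [h.ae_iff (p := fun n => n = 0 ∨ n = 1) (by fun_prop), ae_iff,
    bernoulliMeasure_apply_of_notMem_of_notMem] <;> simp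

theorem memLp_of_hasLaw_bernoulli {X : Ω → ℝ} {p : unitInterval}
    (h : HasLaw X (bernoulliMeasure 1 0 p) P) : MemLp X 2 P := by
  rw [memLp_two_iff_integrable_sq h.aemeasurable.aestronglyMeasurable]
  have : Integrable ((fun x : ℝ => x ^ 2) ∘ X) P := by
    rw [← integrable_map_measure _ h.aemeasurable, h.map_eq]
    · exact integrable_bernoulliMeasure _ _ _ _
    · fun_prop
  exact this

theorem integral_of_hasLaw_bernoulli {X : Ω → ℝ} {p : unitInterval}
    (h : HasLaw X (bernoulliMeasure 1 0 p) P) : P[X] = (p : ℝ) := by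
  rw [h.integral_eq, integral_bernoulliMeasure]; simp

variable [IsProbabilityMeasure P]

/-- If the random variables indexed by pairs are independent, then so are the families obtained by
fixing the first index. -/
theorem iIndepFun_curry {ι κ E : Type*} [Countable ι] [Countable κ] [MeasurableSpace E]
    {X : ι → κ → Ω → E} (hX : ∀ i j, AEMeasurable (X i j) P)
    (h : iIndepFun (fun q : ι × κ => X q.1 q.2) P) :
    iIndepFun (fun i ω j => X i j ω) P := by
  have hprob : ∀ i j, IsProbabilityMeasure (P.map (X i j)) :=
    fun i j => Measure.isProbabilityMeasure_map (hX i j)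
  have hX' : ∀ i, AEMeasurable (fun ω j => X i j ω) P := fun i => aemeasurable_pi_iff.2 (hX i)
  have hX'' : AEMeasurable (fun ω (q : ι × κ) => X q.1 q.2 ω) P :=
    aemeasurable_pi_iff.2 fun q => hX q.1 q.2
  rw [iIndepFun_iff_map_fun_eq_infinitePi_map₀' hX']
  have h1 : ∀ i, P.map (fun ω j => X i j ω) = Measure.infinitePi fun j => P.map (X i j) := fun i =>
    (h.precomp (Prod.mk_right_injective i)).map_fun_eq_infinitePi_map₀' (hX i)
  simp_rw [h1]
  rw [← Measure.infinitePi_map_curry (fun i j => P.map (X i j)),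
    ← show P.map (fun ω (q : ι × κ) => X q.1 q.2 ω) =
      Measure.infinitePi (fun q : ι × κ => P.map (X q.1 q.2)) from
      h.map_fun_eq_infinitePi_map₀' (fun q => hX q.1 q.2),
    AEMeasurable.map_map_of_aemeasurable (by fun_prop) hX'']
  rfl

/-- Portmanteau for the closed sets `{x | ε ≤ dist x c}`, which are null for the Dirac mass at `c`.
-/
theorem tendstoInMeasure_of_tendstoInDistribution_const {X : ℕ → Ω → ℝ} {Ω' : Type*}
    [MeasurableSpace Ω'] {P' : Measure Ω'} [IsProbabilityMeasure P'] {c : ℝ}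
    (h : TendstoInDistribution X atTop (fun _ : Ω' => c) (fun _ => P) P') :
    TendstoInMeasure P X atTop (fun _ => c) := by
  rw [tendstoInMeasure_iff_dist]
  intro ε hε
  have hF : IsClosed {x : ℝ | ε ≤ dist x c} := isClosed_le continuous_const (by fun_prop)
  have h1 := ProbabilityMeasure.limsup_measure_closed_le_of_tendsto h.tendsto hF
  have h2 : (P'.map (fun _ => c)) {x : ℝ | ε ≤ dist x c} = 0 := by
    rw [Measure.map_const, measure_univ, one_smul, Measure.dirac_apply' _ hF.measurableSet]
    simp [hε]
  simp only [ProbabilityMeasure.coe_mk] at h1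
  rw [h2] at h1
  have h3 : ∀ n, (P.map (X n)) {x : ℝ | ε ≤ dist x c} = P {x | ε ≤ dist (X n x) c} := fun n => by
    rw [Measure.map_apply_of_aemeasurable (h.forall_aemeasurable n) hF.measurableSet]; rfl
  simp_rw [h3] at h1
  exact tendsto_of_le_liminf_of_limsup_le (zero_le) h1

/-- Slutsky for `(x, d) ↦ d * |x|`: a sequence converging in law is bounded in probability, and this
form avoids speaking of tightness. -/
theorem tendstoInMeasure_mul_zero {X D : ℕ → Ω → ℝ} {Ω' : Type*}
    [MeasurableSpace Ω'] {P' : Measure Ω'} [IsProbabilityMeasure P'] {Y : Ω' → ℝ}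
    (h : TendstoInDistribution X atTop Y (fun _ => P) P')
    (hD : TendstoInMeasure P D atTop (fun _ => 0)) (hDm : ∀ n, AEMeasurable (D n) P) :
    TendstoInMeasure P (fun n ω => D n ω * |X n ω|) atTop (fun _ => 0) := by
  have := h.continuous_comp_prodMk_of_tendstoInMeasure_const
    (g := fun q : ℝ × ℝ => q.2 * |q.1|) (by fun_prop) hD hDm
  simp only [zero_mul] at this
  exact tendstoInMeasure_of_tendstoInDistribution_const this

theorem tendstoInMeasure_sum_zero {ι : Type*} (s : Finset ι) {X : ι → ℕ → Ω → ℝ}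
    (hX : ∀ i n, AEMeasurable (X i n) P) (h : ∀ i, TendstoInMeasure P (X i) atTop (fun _ => 0)) :
    TendstoInMeasure P (fun n ω => ∑ i ∈ s, X i n ω) atTop (fun _ => 0) := by
  classical
  induction s using Finset.induction_on with
  | empty =>
    refine tendstoInMeasure_of_tendsto_ae (fun n => by simpa using aestronglyMeasurable_const) ?_
    simp
  | insert i s hi ih =>
    have := ((h i).tendstoInDistribution (hX i)).add_of_tendstoInMeasure_const ih
      (fun n => Finset.aemeasurable_fun_sum _ fun i _ => hX i n)
    simp only [add_zero] at this
    simp_rw [Finset.sum_insert hi]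
    exact tendstoInMeasure_of_tendstoInDistribution_const this

/-- A remainder that is almost surely negligible with respect to a finite sum of sequences which
converge in distribution tends to `0` in probability. -/
theorem tendstoInMeasure_zero_of_isLittleO_sum {ι : Type*} [Fintype ι] {E : ι → ℕ → Ω → ℝ}
    {R : ℕ → Ω → ℝ} {Ω' : Type*} [MeasurableSpace Ω'] {P' : Measure Ω'} [IsProbabilityMeasure P']
    {Y : ι → Ω' → ℝ} (hE : ∀ i, TendstoInDistribution (E i) atTop (Y i) (fun _ => P) P')
    (hR : ∀ n, AEMeasurable (R n) P)
    (h : ∀ᵐ ω ∂P, (fun n => R n ω) =o[atTop] fun n => ∑ i, |E i n ω|) :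
    TendstoInMeasure P R atTop (fun _ => 0) := by
  have hEm : ∀ i n, AEMeasurable (E i n) P := fun i n => (hE i).forall_aemeasurable n
  have hEa : ∀ i n, AEMeasurable (fun ω => |E i n ω|) P := fun i n =>
    measurable_norm.comp_aemeasurable (hEm i n)
  have hBm : ∀ n, AEMeasurable (fun ω => ∑ i, |E i n ω|) P := fun n =>
    Finset.aemeasurable_fun_sum _ fun i _ => hEa i n
  set D : ℕ → Ω → ℝ := fun n ω => R n ω / ∑ i, |E i n ω| with hDdef
  have hDm : ∀ n, AEMeasurable (D n) P := fun n => (hR n).div (hBm n)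
  have hD : TendstoInMeasure P D atTop (fun _ => 0) := by
    refine tendstoInMeasure_of_tendsto_ae (fun n => (hDm n).aestronglyMeasurable) ?_
    filter_upwards [h] with ω hω using hω.tendsto_div_nhds_zero
  have hSm : ∀ i n, AEMeasurable (fun ω => D n ω * |E i n ω|) P := fun i n =>
    (hDm n).mul (hEa i n)
  have hS := tendstoInMeasure_sum_zero Finset.univ hSm
    fun i => tendstoInMeasure_mul_zero (hE i) hD hDm
  -- `R = D * ∑ |E|` can fail only where `∑ |E| = 0`, since division by zero gives `D = 0`; there
  -- the little-o bound forces `R = 0` for large `n`.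
  have hdiff : TendstoInMeasure P (fun n ω => R n ω - ∑ i, D n ω * |E i n ω|) atTop
      (fun _ => 0) := by
    refine tendstoInMeasure_of_tendsto_ae (fun n => ((hR n).sub
      (Finset.aemeasurable_fun_sum _ fun i _ => hSm i n)).aestronglyMeasurable) ?_
    filter_upwards [h] with ω hω
    refine tendsto_const_nhds.congr' ?_
    filter_upwards [hω.bound one_pos] with n hn
    rw [← Finset.mul_sum, hDdef]
    by_cases h0 : ∑ i, |E i n ω| = 0
    · rw [h0] at hn ⊢
      simp at hn ⊢
      exact hn.symm
    · field_simp
      simp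
  -- A sum of two null sequences is treated as a finite sum indexed by `Bool`.
  have := tendstoInMeasure_sum_zero (X := fun (b : Bool) n ω => if b then ∑ i, D n ω * |E i n ω|
    else R n ω - ∑ i, D n ω * |E i n ω|) Finset.univ
    (by
      rintro (_ | _) n
      · simpa using (hR n).fun_sub (Finset.aemeasurable_fun_sum _ fun i _ => hSm i n)
      · simpa using Finset.aemeasurable_fun_sum _ fun i _ => hSm i n)
    (by
      rintro (_ | _)
      · simpa using hdiff
      · simpa using hS)
  simpa using this

theorem variance_of_hasLaw_bernoulli {X : Ω → ℝ} {p : unitInterval}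
    (h : HasLaw X (bernoulliMeasure 1 0 p) P) : Var[X; P] = p * (1 - p) := by
  rw [variance_eq_sub (memLp_of_hasLaw_bernoulli h), integral_of_hasLaw_bernoulli h]
  have := h.integral_comp (f := fun x : ℝ => x ^ 2) (by fun_prop)
  rw [integral_bernoulliMeasure] at this
  have h2 : P[X ^ 2] = (p : ℝ) := by
    rw [show X ^ 2 = (fun x : ℝ => x ^ 2) ∘ X from rfl, this]; simp
  rw [h2]; ring

/-- Central limit theorem for a linear combination of independent Bernoulli sequences. -/
theorem tendstoInDistribution_weighted_bernoulli {ι : Type*} [Fintype ι] {X : ι → ℕ → Ω → ℝ}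
    {p : ι → unitInterval} (hlaw : ∀ i k, HasLaw (X i k) (bernoulliMeasure 1 0 (p i)) P)
    (hindep : iIndepFun (fun q : ι × ℕ => X q.1 q.2) P) (c : ι → ℝ) {Ω' : Type*}
    [MeasurableSpace Ω'] {P' : Measure Ω'} [IsProbabilityMeasure P'] {Y : Ω' → ℝ}
    (hY : HasLaw Y (gaussianReal 0 (∑ i, c i ^ 2 * (p i * (1 - p i)) : ℝ).toNNReal) P') :
    TendstoInDistribution (fun (n : ℕ) ω => (√n)⁻¹ *
      ∑ k ∈ Finset.range n, ∑ i, c i * (X i k ω - p i)) atTop Y (fun _ => P) P' := by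
  have hm : ∀ i k, AEMeasurable (X i k) P := fun i k => (hlaw i k).aemeasurable
  have hL : ∀ i k, MemLp (fun ω => c i * X i k ω) 2 P := fun i k =>
    (memLp_of_hasLaw_bernoulli (hlaw i k)).const_mul _
  have hcol : ∀ k, iIndepFun (fun i => X i k) P := fun k =>
    hindep.precomp (Prod.mk_left_injective k)
  have hswap : iIndepFun (fun q : ℕ × ι => X q.2 q.1) P :=
    hindep.precomp (g := Prod.swap) Prod.swap_injective
  -- Grouping by trial number `k` makes the weighted sums over the cells an i.i.d. sequence, so the
  -- one-dimensional theorem suffices.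
  have hind : iIndepFun (fun k ω => ∑ i, c i * X i k ω) P :=
    (iIndepFun_curry (X := fun k i => X i k) (fun k i => hm i k) hswap).comp
      (fun _ x => ∑ i, c i * x i) (fun _ => by fun_prop)
  have hid : ∀ k, IdentDistrib (fun ω => ∑ i, c i * X i k ω) (fun ω => ∑ i, c i * X i 0 ω) P P :=
    fun k => (IdentDistrib.pi (X := fun i => X i k) (Y := fun i => X i 0)
      (fun i => ⟨hm i k, hm i 0, by rw [(hlaw i k).map_eq, (hlaw i 0).map_eq]⟩)
      (hcol k) (hcol 0)).comp (u := fun x : ι → ℝ => ∑ i, c i * x i) (by fun_prop)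
  have hmean : ∫ ω, ∑ i, c i * X i 0 ω ∂P = ∑ i, c i * p i := by
    rw [integral_finsetSum _ fun i _ => (hL i 0).integrable (by norm_num)]
    refine Finset.sum_congr rfl fun i _ => ?_
    rw [integral_const_mul, integral_of_hasLaw_bernoulli (hlaw i 0)]
  have hvar : Var[fun ω => ∑ i, c i * X i 0 ω; P] = ∑ i, c i ^ 2 * (p i * (1 - p i)) := by
    have h1 := IndepFun.variance_sum (μ := P) (s := Finset.univ)
      (X := fun i ω => c i * X i 0 ω) (fun i _ => hL i 0) (fun i _ j _ hij =>
        ((hcol 0).indepFun hij).comp (φ := fun x => c i * x) (ψ := fun x => c j * x)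
          (by fun_prop) (by fun_prop))
    have h2 : (∑ i, fun ω => c i * X i 0 ω) = fun ω => ∑ i, c i * X i 0 ω := by
      ext; simp
    rw [h2] at h1
    rw [h1]
    refine Finset.sum_congr rfl fun i _ => ?_
    rw [variance_const_mul, variance_of_hasLaw_bernoulli (hlaw i 0)]
  have := tendstoInDistribution_inv_sqrt_mul_sum_sub (P := P) (P' := P') (Y := Y)
    (X := fun k ω => ∑ i, c i * X i k ω) (by rw [hvar]; exact hY)
    (memLp_finsetSum _ fun i _ => hL i 0) hind hid
  refine this.congr (fun n => ae_of_all _ fun ω => ?_) (ae_eq_refl _)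
  simp only [hmean, mul_sub, Finset.sum_sub_distrib]
  simp

/-- The strong law of large numbers for the relative frequency of a Bernoulli sequence. -/
theorem ae_tendsto_freq_of_bernoulli {X : ℕ → Ω → ℝ} {p : unitInterval}
    (hlaw : ∀ k, HasLaw (X k) (bernoulliMeasure 1 0 p) P) (hindep : iIndepFun X P) :
    ∀ᵐ ω ∂P, Tendsto (fun n : ℕ => (∑ k ∈ Finset.range n, X k ω) / n) atTop (𝓝 (p : ℝ)) := by
  have := strong_law_ae_real X ((memLp_of_hasLaw_bernoulli (hlaw 0)).integrable (by norm_num))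
    (fun i j hij => hindep.indepFun hij)
    (fun i => ⟨(hlaw i).aemeasurable, (hlaw 0).aemeasurable, by
      rw [(hlaw i).map_eq, (hlaw 0).map_eq]⟩)
  rwa [integral_of_hasLaw_bernoulli (hlaw 0)] at this

/-- Slutsky's theorem for a studentized statistic. -/
theorem tendstoInDistribution_studentized {G R S : ℕ → Ω → ℝ} {v : ℝ} (hv : 0 < v)
    (hG : TendstoInDistribution G atTop (fun x : ℝ => √v * x) (fun _ => P) (gaussianReal 0 1))
    (hR : TendstoInMeasure P R atTop (fun _ => 0)) (hRm : ∀ n, AEMeasurable (R n) P)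
    (hS : ∀ᵐ ω ∂P, Tendsto (fun n => S n ω) atTop (𝓝 v)) (hSm : ∀ n, AEMeasurable (S n) P) :
    TendstoInDistribution (fun n ω => (√(S n ω))⁻¹ * (G n ω + R n ω)) atTop
      (id : ℝ → ℝ) (fun _ => P) (gaussianReal 0 1) := by
  have h1 := hG.add_of_tendstoInMeasure_const hR hRm
  have hSm' : ∀ n, AEMeasurable (fun ω => (√(S n ω))⁻¹) P := fun n =>
    (Real.continuous_sqrt.measurable.comp_aemeasurable (hSm n)).inv
  have hS' : TendstoInMeasure P (fun n ω => (√(S n ω))⁻¹) atTop (fun _ => (√v)⁻¹) := by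
    refine tendstoInMeasure_of_tendsto_ae (fun n => (hSm' n).aestronglyMeasurable) ?_
    filter_upwards [hS] with ω hω
    exact ((Real.continuous_sqrt.tendsto v).comp hω).inv₀ (Real.sqrt_pos.2 hv).ne'
  have h2 := h1.continuous_comp_prodMk_of_tendstoInMeasure_const
    (g := fun q : ℝ × ℝ => q.2 * q.1) (by fun_prop) hS' hSm'
  refine h2.congr (fun n => ae_of_all _ fun ω => by simp) (ae_of_all _ fun x => ?_)
  have := (Real.sqrt_pos.2 hv).ne'
  simp [field]

end Prob

/-! ### The objective of a single cell and its gap. -/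

namespace OneShot

open scoped Topology

/-- The contribution of a cell with relative failure frequency `x` and failure probability `p` to
the objective function. -/
noncomputable def cellObj (β x p : ℝ) : ℝ :=
  if β = 0 then x * Real.log (x / p) + (1 - x) * Real.log ((1 - x) / (1 - p))
  else p ^ (β + 1) + (1 - p) ^ (β + 1) - (1 + β) / β * (x * p ^ β + (1 - x) * (1 - p) ^ β)

/-- The Bregman divergence of `x ↦ x ^ (β + 1)`. -/
noncomputable def powBregman (β x p : ℝ) : ℝ := x ^ (β + 1) + β * p ^ (β + 1) - (β + 1) * (x * p ^ β)

/-- A continuous lower bound for the excess of `cellObj β x p` over its minimum. -/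
noncomputable def cellGap (β x p : ℝ) : ℝ :=
  if β = 0 then (√x - √p) ^ 2 + (√(1 - x) - √(1 - p)) ^ 2
  else (powBregman β x p + powBregman β (1 - x) (1 - p)) / β

theorem powBregman_self {β x : ℝ} (hβ : 0 < β) (hx : 0 ≤ x) : powBregman β x x = 0 := by
  rw [powBregman, Real.rpow_add_one' hx (by positivity)]; ring

/-- For `p > 0`, divide by `p ^ (β + 1)`: this is the strict Bernoulli inequality with exponent `β +
1` at `x / p - 1`. -/
theorem powBregman_pos {β x p : ℝ} (hβ : 0 < β) (hx : 0 ≤ x) (hp : 0 ≤ p) (h : x ≠ p) :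
    0 < powBregman β x p := by
  rcases hp.eq_or_lt with rfl | hp
  · have hx' : 0 < x := lt_of_le_of_ne hx h.symm
    rw [powBregman, Real.zero_rpow (by positivity), Real.zero_rpow hβ.ne']
    have := Real.rpow_pos_of_pos hx' (β + 1)
    simpa using this
  · have h1 := one_add_mul_self_lt_rpow_one_add (s := x / p - 1) (p := β + 1)
      (by have : 0 ≤ x / p := by positivity
          linarith)
      (by rw [sub_ne_zero]; intro h2; rw [div_eq_one_iff_eq hp.ne'] at h2; exact h h2)
      (by linarith)
    have h2 : 0 < p ^ β := Real.rpow_pos_of_pos hp β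
    rw [add_sub_cancel, Real.div_rpow hx hp.le, Real.rpow_add_one hp.ne',
      lt_div_iff₀ (by positivity)] at h1
    have h3 : (1 + (β + 1) * (x / p - 1)) * (p ^ β * p) = (β + 1) * (x * p ^ β) - β * (p ^ β * p) := by
      field_simp; ring
    rw [h3] at h1
    rw [powBregman, Real.rpow_add_one hp.ne']
    linarith

theorem powBregman_nonneg {β x p : ℝ} (hβ : 0 < β) (hx : 0 ≤ x) (hp : 0 ≤ p) :
    0 ≤ powBregman β x p := by
  by_cases h : x = p
  · rw [h, powBregman_self hβ hp]
  · exact (powBregman_pos hβ hx hp h).le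

theorem cellGap_pos {β x p : ℝ} (hβ : 0 ≤ β) (hx : x ∈ Set.Icc (0 : ℝ) 1)
    (hp : p ∈ Set.Icc (0 : ℝ) 1) (h : x ≠ p) : 0 < cellGap β x p := by
  rw [cellGap]
  split_ifs with h0
  · have h1 : √x - √p ≠ 0 := by
      rw [sub_ne_zero, Ne, Real.sqrt_inj hx.1 hp.1]; exact h
    positivity
  · have hβ' : 0 < β := lt_of_le_of_ne hβ (Ne.symm h0)
    have h1 := powBregman_pos hβ' hx.1 hp.1 h
    have h2 := powBregman_nonneg hβ' (sub_nonneg.2 hx.2) (sub_nonneg.2 hp.2)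
    positivity

theorem cellGap_nonneg {β x p : ℝ} (hβ : 0 ≤ β) (hx : x ∈ Set.Icc (0 : ℝ) 1)
    (hp : p ∈ Set.Icc (0 : ℝ) 1) : 0 ≤ cellGap β x p := by
  by_cases h : x = p
  · subst h
    rw [cellGap]
    split_ifs with h0
    · positivity
    · have hβ' : 0 < β := lt_of_le_of_ne hβ (Ne.symm h0)
      rw [powBregman_self hβ' hx.1, powBregman_self hβ' (sub_nonneg.2 hx.2)]
      simp
  · exact (cellGap_pos hβ hx hp h).le

/-- Both exponents are nonnegative, so continuity reaches the boundary of the unit square, which the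
compactness argument needs. For `β = 0` the logarithms in `cellObj` would not allow this. -/
theorem continuous_cellGap {β : ℝ} (hβ : 0 ≤ β) :
    Continuous fun q : ℝ × ℝ => cellGap β q.1 q.2 := by
  unfold cellGap powBregman
  split_ifs with h0
  · fun_prop
  · have h1 : Continuous fun x : ℝ => x ^ (β + 1) := Real.continuous_rpow_const (by positivity)
    have h2 : Continuous fun x : ℝ => x ^ β := Real.continuous_rpow_const hβ
    have a1 := h1.comp (continuous_fst (X := ℝ) (Y := ℝ))
    have a2 := h1.comp (continuous_snd (X := ℝ) (Y := ℝ))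
    have a3 := h2.comp (continuous_snd (X := ℝ) (Y := ℝ))
    have a4 := h1.comp (continuous_const.sub (continuous_fst (X := ℝ) (Y := ℝ)) : Continuous
      fun q : ℝ × ℝ => 1 - q.1)
    have a5 := h1.comp (continuous_const.sub (continuous_snd (X := ℝ) (Y := ℝ)) : Continuous
      fun q : ℝ × ℝ => 1 - q.2)
    have a6 := h2.comp (continuous_const.sub (continuous_snd (X := ℝ) (Y := ℝ)) : Continuous
      fun q : ℝ × ℝ => 1 - q.2)
    simp only [Function.comp_def] at a1 a2 a3 a4 a5 a6
    fun_prop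

/-- Apply `log u ≥ 1 - u⁻¹` to `u = √x / √p`. The terms `x - p` cancel when the contributions of
failure and survival are added. -/
theorem mul_log_div_ge {x p : ℝ} (hx : 0 ≤ x) (hp : 0 < p) :
    x - p + (√x - √p) ^ 2 ≤ x * Real.log (x / p) := by
  rcases hx.eq_or_lt with rfl | hx
  · simp [Real.sq_sqrt hp.le]
  · obtain ⟨s, hs, rfl⟩ : ∃ s, 0 < s ∧ s ^ 2 = x := ⟨√x, Real.sqrt_pos.2 hx, Real.sq_sqrt hx.le⟩
    obtain ⟨q, hq, rfl⟩ : ∃ q, 0 < q ∧ q ^ 2 = p := ⟨√p, Real.sqrt_pos.2 hp, Real.sq_sqrt hp.le⟩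
    rw [Real.sqrt_sq hs.le, Real.sqrt_sq hq.le, ← div_pow, Real.log_pow]
    have h1 := Real.one_sub_inv_le_log_of_pos (div_pos hs hq)
    have h2 : s ^ 2 * (2 * (1 - (s / q)⁻¹)) ≤ s ^ 2 * (2 * Real.log (s / q)) := by gcongr
    have h3 : s ^ 2 * (2 * (1 - (s / q)⁻¹)) = 2 * s ^ 2 - 2 * s * q := by
      field_simp
    push_cast
    nlinarith

/-- An equality for `β > 0`; for `β = 0`, the bound of the Kullback-Leibler divergence from below by
the Hellinger-type distance. -/
theorem cellGap_le {β x p : ℝ} (hβ : 0 ≤ β) (hx : x ∈ Set.Icc (0 : ℝ) 1)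
    (hp : p ∈ Set.Ioo (0 : ℝ) 1) : cellGap β x p ≤ cellObj β x p - cellObj β x x := by
  rw [cellGap, cellObj, cellObj]
  split_ifs with h0
  · have h1 := mul_log_div_ge hx.1 hp.1
    have h2 := mul_log_div_ge (sub_nonneg.2 hx.2) (sub_pos.2 hp.2)
    have h3 : ∀ z : ℝ, z * Real.log (z / z) = 0 := fun z => by
      by_cases hz : z = 0 <;> simp [hz]
    rw [h3, h3]
    linarith
  · have hβ' : 0 < β := lt_of_le_of_ne hβ (Ne.symm h0)
    have h1 := Real.rpow_add_one' hx.1 (y := β) (by positivity)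
    have h2 := Real.rpow_add_one' (sub_nonneg.2 hx.2) (y := β) (by positivity)
    rw [powBregman, powBregman, h1, h2]
    apply le_of_eq
    field_simp
    ring

theorem hasDerivAt_cellObj {β x p : ℝ} (hβ : 0 ≤ β) (hp : p ∈ Set.Ioo (0 : ℝ) 1) :
    HasDerivAt (cellObj β x)
      ((β + 1) * ((p ^ (β - 1) + (1 - p) ^ (β - 1)) * (p - x))) p := by
  have hp0 : p ≠ 0 := hp.1.ne'
  have hq : 0 < 1 - p := sub_pos.2 hp.2
  have hsub : HasDerivAt (fun p : ℝ => 1 - p) (-1) p := by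
    simpa using (hasDerivAt_id p).const_sub 1
  by_cases h0 : β = 0
  · have e : cellObj β x = fun p => x * Real.log (x / p) + (1 - x) * Real.log ((1 - x) / (1 - p)) := by
      ext p; rw [cellObj, if_pos h0]
    rw [e]
    have key : ∀ z r : ℝ, 0 < r →
        HasDerivAt (fun r => z * Real.log (z / r)) (-z / r) r := by
      intro z r hr
      by_cases hz : z = 0
      · simpa [hz] using hasDerivAt_const r (0 : ℝ)
      · have h1 : HasDerivAt (fun r => z * (Real.log z - Real.log r)) (z * (0 - r⁻¹)) r :=
          ((hasDerivAt_const r (Real.log z)).sub (Real.hasDerivAt_log hr.ne')).const_mul z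
        refine (h1.congr_of_eventuallyEq ?_).congr_deriv (by field_simp; ring)
        filter_upwards [lt_mem_nhds hr] with s hs
        rw [Real.log_div hz hs.ne']
    have h1 := (key x p hp.1).add ((key (1 - x) (1 - p) hq).comp p hsub)
    refine h1.congr_deriv ?_
    subst h0
    rw [zero_sub, Real.rpow_neg_one, Real.rpow_neg_one]
    field_simp
    ring
  · have e : cellObj β x = fun p => p ^ (β + 1) + (1 - p) ^ (β + 1)
        - (1 + β) / β * (x * p ^ β + (1 - x) * (1 - p) ^ β) := by
      ext p; rw [cellObj, if_neg h0]
    rw [e]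
    have k1 : ∀ b : ℝ, HasDerivAt (fun p : ℝ => p ^ b) (b * p ^ (b - 1)) p := fun b =>
      Real.hasDerivAt_rpow_const (Or.inl hp0)
    have k2 : ∀ b : ℝ, HasDerivAt (fun p : ℝ => (1 - p) ^ b) (b * (1 - p) ^ (b - 1) * (-1)) p :=
      fun b => (Real.hasDerivAt_rpow_const (Or.inl hq.ne')).comp p hsub
    have h1 := ((k1 (β + 1)).add (k2 (β + 1))).sub
      ((((k1 β).const_mul x).add ((k2 β).const_mul (1 - x))).const_mul ((1 + β) / β))
    refine h1.congr_deriv ?_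
    have e1 : p ^ (β + 1 - 1) = p ^ (β - 1) * p := by
      rw [← Real.rpow_add_one hp0]; ring_nf
    have e2 : (1 - p) ^ (β + 1 - 1) = (1 - p) ^ (β - 1) * (1 - p) := by
      rw [← Real.rpow_add_one hq.ne']; ring_nf
    rw [e1, e2]
    field_simp
    ring

theorem tendsto_cellObj_sub_self (β : ℝ) {p : ℝ} (hp : p ∈ Set.Ioo (0 : ℝ) 1) :
    Tendsto (fun x => cellObj β x p - cellObj β x x) (𝓝 p) (𝓝 0) := by
  have hp0 : p ≠ 0 := hp.1.ne'
  have hq : 1 - p ≠ 0 := (sub_pos.2 hp.2).ne'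
  have hc : ContinuousAt (fun x => cellObj β x p - cellObj β x x) p := by
    unfold cellObj
    split_ifs with h0
    · have h1 : p / p ≠ 0 := div_ne_zero hp0 hp0
      have h2 : (1 - p) / (1 - p) ≠ 0 := div_ne_zero hq hq
      fun_prop (disch := assumption)
    · have k : ∀ b : ℝ, ContinuousAt (fun x : ℝ => x ^ b) p := fun b =>
        Real.continuousAt_rpow_const _ _ (Or.inl hp0)
      have k' : ∀ b : ℝ, ContinuousAt (fun x : ℝ => (1 - x) ^ b) p := fun b =>
        ContinuousAt.comp (f := fun x : ℝ => 1 - x) (g := fun x : ℝ => x ^ b)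
          (Real.continuousAt_rpow_const (1 - p) b (Or.inl hq)) (by fun_prop)
      have a1 := k (β + 1)
      have a2 := k β
      have a3 := k' (β + 1)
      have a4 := k' β
      exact (continuousAt_const.sub (continuousAt_const.mul ((continuousAt_id.mul
        continuousAt_const).add ((continuousAt_const.sub continuousAt_id).mul
        continuousAt_const)))).sub ((a1.add a3).sub (continuousAt_const.mul
        ((continuousAt_id.mul a2).add ((continuousAt_const.sub continuousAt_id).mul a4))))
  simpa [ContinuousAt] using hc

/-- The objective function separates a failure probability from the remote ones, uniformly in the
relative frequencies close to it. -/
theorem exists_le_cellObj_sub {β p₀ ε : ℝ} (hβ : 0 ≤ β) (hε : 0 < ε) :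
    ∃ δ > 0, ∀ x ∈ Set.Icc (0 : ℝ) 1, ∀ p ∈ Set.Ioo (0 : ℝ) 1, |x - p₀| ≤ ε / 2 → ε ≤ |p - p₀| →
      δ ≤ cellObj β x p - cellObj β x x := by
  set C : Set (ℝ × ℝ) := (Set.Icc (0 : ℝ) 1 ×ˢ Set.Icc (0 : ℝ) 1) ∩
    {q | |q.1 - p₀| ≤ ε / 2 ∧ ε ≤ |q.2 - p₀|} with hC
  have hCc : IsCompact C := (isCompact_Icc.prod isCompact_Icc).inter_right
    (IsClosed.inter (s₁ := {q : ℝ × ℝ | |q.1 - p₀| ≤ ε / 2}) (s₂ := {q | ε ≤ |q.2 - p₀|})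
      (isClosed_le (by fun_prop) (by fun_prop)) (isClosed_le (by fun_prop) (by fun_prop)))
  rcases C.eq_empty_or_nonempty with he | hne
  · refine ⟨1, one_pos, fun x hx p hp h1 h2 => ?_⟩
    have : (x, p) ∈ C := ⟨⟨hx, Set.Ioo_subset_Icc_self hp⟩, h1, h2⟩
    rw [he] at this
    exact this.elim
  · obtain ⟨q, hq, hmin⟩ := hCc.exists_isMinOn hne (continuous_cellGap hβ).continuousOn
    -- A diagonal point of `C` would give `ε ≤ ε / 2`.
    have hqne : q.1 ≠ q.2 := by
      intro h
      have h1 := hq.2.1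
      have h2 := hq.2.2
      rw [h] at h1
      linarith
    refine ⟨_, cellGap_pos hβ hq.1.1 hq.1.2 hqne, fun x hx p hp h1 h2 => ?_⟩
    exact (hmin (a := (x, p)) ⟨⟨hx, Set.Ioo_subset_Icc_self hp⟩, h1, h2⟩).trans
      (cellGap_le hβ hx hp)

end OneShot

/-! ### Deterministic linearization of an estimating equation. -/

section Linearization

open scoped Topology

/-- Linearization of the solutions of an estimating equation `∑ i, (π i a - x i) • u i a = 0`. -/
theorem isLittleO_of_estimatingEquation {ι E T : Type*} [Fintype ι] [NormedAddCommGroup E]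
    [NormedSpace ℝ E] {l : Filter T} {α : E} {π : ι → E → ℝ} {π' : ι → E →L[ℝ] ℝ} {u : ι → E → E}
    {a : T → E} {x : T → ι → ℝ} {B : E →L[ℝ] E} (ha : Tendsto a l (𝓝 α))
    (hπ : ∀ i, HasFDerivAt (π i) (π' i) α) (hu : ∀ i, ContinuousAt (u i) α)
    (hB : ∀ r, B (∑ i, π' i r • u i α) = r)
    (heq : ∀ᶠ τ in l, ∑ i, (π i (a τ) - x τ i) • u i (a τ) = 0) :
    (fun τ => a τ - α - B (∑ i, (x τ i - π i α) • u i α))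
      =o[l] fun τ => ∑ i, |x τ i - π i α| := by
  set r : T → E := fun τ => a τ - α
  set S : T → ℝ := fun τ => ∑ i, |x τ i - π i α|
  have hu0 : ∀ i, (fun τ => u i (a τ) - u i α) =o[l] fun _ => (1 : ℝ) := fun i => by
    rw [Asymptotics.isLittleO_one_iff]
    simpa using ((hu i).tendsto.comp ha).sub_const (u i α)
  have hu1 : ∀ i, (fun τ => u i (a τ)) =O[l] fun _ => (1 : ℝ) := fun i =>
    ((hu i).tendsto.comp ha).isBigO_one ℝ
  have hq : ∀ i, (fun τ => π i (a τ) - π i α - π' i (r τ)) =o[l] r := fun i =>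
    (hπ i).isLittleO.comp_tendsto ha
  have hlin : ∀ i, (fun τ => π' i (r τ)) =O[l] r := fun i => (π' i).isBigO_comp r l
  have he : ∀ i, (fun τ => x τ i - π i α) =O[l] S := fun i =>
    Asymptotics.IsBigO.of_bound 1 (Eventually.of_forall fun τ => by
      rw [one_mul, Real.norm_eq_abs]
      exact (Finset.single_le_sum (f := fun i => |x τ i - π i α|) (fun _ _ => abs_nonneg _)
        (Finset.mem_univ i)).trans (le_abs_self _))
  have h1 : (fun τ => ∑ i, ((π i (a τ) - π i α - π' i (r τ)) • u i (a τ)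
      + π' i (r τ) • (u i (a τ) - u i α))) =o[l] r := by
    refine Asymptotics.IsLittleO.fun_sum fun i _ => ?_
    have k1 := (hq i).norm_right.smul_isBigO (hu1 i)
    have k2 := (hlin i).norm_right.smul_isLittleO (hu0 i)
    simp only [smul_eq_mul, mul_one] at k1 k2
    exact (k1.add k2).of_norm_right
  have h2 : (fun τ => ∑ i, (x τ i - π i α) • (u i (a τ) - u i α)) =o[l] S := by
    refine Asymptotics.IsLittleO.fun_sum fun i _ => ?_
    have k := (he i).smul_isLittleO (hu0 i)
    simpa only [smul_eq_mul, mul_one] using k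
  -- Write `r` as `B (∑ π' r • u)` and subtract the estimating equation inside `B`. The identity is
  -- exact, and only differences already known to be small remain. The `u i` need only be
  -- continuous.
  have hid : (fun τ => r τ - B (∑ i, (x τ i - π i α) • u i α)) =ᶠ[l] fun τ =>
      B (∑ i, (x τ i - π i α) • (u i (a τ) - u i α)) - B (∑ i,
        ((π i (a τ) - π i α - π' i (r τ)) • u i (a τ) + π' i (r τ) • (u i (a τ) - u i α))) := by
    filter_upwards [heq] with τ hτ
    nth_rewrite 1 [← hB (r τ)]
    rw [← map_sub, ← map_sub]
    congr 1
    rw [← sub_eq_zero, ← Finset.sum_sub_distrib, ← Finset.sum_sub_distrib,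
      ← Finset.sum_sub_distrib, ← hτ]
    refine Finset.sum_congr rfl fun i _ => ?_
    module
  have h1' := ((B.isBigO_comp _ l).trans_isLittleO h1)
  have h2' := ((B.isBigO_comp _ l).trans_isLittleO h2)
  have h3 : (fun τ => B (∑ i, (x τ i - π i α) • u i α)) =O[l] S := by
    refine (B.isBigO_comp _ l).trans (Asymptotics.IsBigO.fun_sum fun i _ => ?_)
    have k := (he i).smul (Asymptotics.isBigO_refl (fun _ : T => u i α) l)
    refine k.trans ?_
    refine Asymptotics.IsBigO.of_bound ‖u i α‖ (Eventually.of_forall fun τ => ?_)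
    rw [norm_smul, mul_comm]
  -- The term of order `o(r)` is absorbed on the left, which leaves `r` bounded by quantities of
  -- order `S`.
  have hr : r =O[l] S := by
    refine (h1'.neg_left.right_isBigO_sub).trans ((h2'.isBigO.add h3).congr' ?_ (by rfl))
    filter_upwards [hid] with τ hτ
    rw [sub_eq_iff_eq_add] at hτ
    have key : ∀ b c d e : E, e = b - c + d → b + d = e - -c := by
      rintro b c d _ rfl
      abel
    exact key _ _ _ _ hτ
  exact (h2'.sub (h1'.trans_isBigO hr)).congr' hid.symm (EventuallyEq.refl _ _)

end Linearization

/-! ### Failure probabilities: derivatives and identifiability. -/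

namespace OneShot

open scoped Topology

theorem isOpen_Theta : IsOpen Theta := isOpen_lt continuous_const (continuous_apply 0)

theorem rate_pos {w : ℝ} {α : Fin 2 → ℝ} (hα : α ∈ Theta) : 0 < rate w α :=
  mul_pos hα (Real.exp_pos _)

theorem failProb_mem_Ioo {w t : ℝ} {α : Fin 2 → ℝ} (hα : α ∈ Theta) (ht : 0 < t) :
    failProb w t α ∈ Set.Ioo (0 : ℝ) 1 := by
  have h1 : Real.exp (-(rate w α * t)) < 1 :=
    Real.exp_lt_one_iff.mpr (neg_neg_of_pos (mul_pos (rate_pos hα) ht))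
  have h2 := Real.exp_pos (-(rate w α * t))
  unfold failProb
  constructor <;> linarith

/-- The direction `(1 / α₀, w)` of the gradient of the failure probability. -/
noncomputable def dir (w : ℝ) (α : Fin 2 → ℝ) : Fin 2 → ℝ := ![1 / α 0, w]

/-- The gradient of the failure probability. -/
noncomputable def grad (w t : ℝ) (α : Fin 2 → ℝ) : Fin 2 → ℝ := (t * dens w t α) • dir w α

/-- The weight of a cell in the estimating equation. -/
noncomputable def weight (β p : ℝ) : ℝ := p ^ (β - 1) + (1 - p) ^ (β - 1)

/-- The coefficient of a cell in the estimating equation. -/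
noncomputable def score (β w t : ℝ) (α : Fin 2 → ℝ) : Fin 2 → ℝ :=
  weight β (failProb w t α) • grad w t α

/-- The linear form `r ↦ g ⬝ᵥ r`. -/
noncomputable def dotCLM (g : Fin 2 → ℝ) : (Fin 2 → ℝ) →L[ℝ] ℝ :=
  LinearMap.toContinuousLinearMap (dotProductBilin ℝ ℝ g)

theorem dotCLM_apply (g r : Fin 2 → ℝ) : dotCLM g r = g ⬝ᵥ r := rfl

theorem hasFDerivAt_failProb {w t : ℝ} {α : Fin 2 → ℝ} (hα : α ∈ Theta) :
    HasFDerivAt (failProb w t) (dotCLM (grad w t α)) α := by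
  have h0 : HasFDerivAt (fun a : Fin 2 → ℝ => a 0)
    (ContinuousLinearMap.proj (R := ℝ) (φ := fun _ : Fin 2 => ℝ) 0) α := hasFDerivAt_apply 0 α
  have h1 : HasFDerivAt (fun a : Fin 2 → ℝ => a 1)
    (ContinuousLinearMap.proj (R := ℝ) (φ := fun _ : Fin 2 => ℝ) 1) α := hasFDerivAt_apply 1 α
  have h := ((((h0.mul (h1.mul_const w).exp).mul_const t).neg).exp).const_sub 1
  refine h.congr_fderiv ?_
  have hne : α 0 ≠ 0 := ne_of_gt hα
  ext1 r
  simp [dotCLM_apply, grad, dir, dens, rate, dotProduct, Fin.sum_univ_two]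
  field_simp
  ring

theorem continuous_failProb (w t : ℝ) : Continuous (failProb w t) := by
  unfold failProb rate; fun_prop

theorem continuous_dens (w t : ℝ) : Continuous (dens w t) := by
  unfold dens rate; fun_prop

theorem continuousAt_failProb_rpow {w t : ℝ} (ht : 0 < t) {α : Fin 2 → ℝ} (hα : α ∈ Theta) (b : ℝ) :
    ContinuousAt (fun a => failProb w t a ^ b) α :=
  (Real.continuousAt_rpow_const _ b (Or.inl (failProb_mem_Ioo hα ht).1.ne')).comp
    (continuous_failProb w t).continuousAt

theorem continuousAt_one_sub_failProb_rpow {w t : ℝ} (ht : 0 < t) {α : Fin 2 → ℝ} (hα : α ∈ Theta)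
    (b : ℝ) : ContinuousAt (fun a => (1 - failProb w t a) ^ b) α :=
  ContinuousAt.comp (f := fun a => 1 - failProb w t a) (g := fun x : ℝ => x ^ b)
    (Real.continuousAt_rpow_const _ b (Or.inl (sub_pos.2 (failProb_mem_Ioo hα ht).2).ne'))
    (continuous_const.sub (continuous_failProb w t)).continuousAt

theorem continuousAt_dir (w : ℝ) {α : Fin 2 → ℝ} (hα : α ∈ Theta) : ContinuousAt (dir w) α := by
  have hne : α 0 ≠ 0 := ne_of_gt hα
  unfold dir
  refine continuousAt_pi.2 fun k => ?_
  fin_cases k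
  · exact continuousAt_const.div (continuous_apply 0).continuousAt hne
  · exact continuousAt_const

theorem continuousAt_score {β w t : ℝ} (ht : 0 < t) {α : Fin 2 → ℝ} (hα : α ∈ Theta) :
    ContinuousAt (score β w t) α :=
  ((continuousAt_failProb_rpow ht hα (β - 1)).add
    (continuousAt_one_sub_failProb_rpow ht hα (β - 1))).smul
    ((continuousAt_const.mul (continuous_dens w t).continuousAt).smul (continuousAt_dir w hα))

/-- Two failure probabilities at distinct temperatures determine the parameter continuously. -/
theorem exists_dist_lt_of_failProb {w w' t r : ℝ} (hw : w ≠ w') (ht : 0 < t) {α : Fin 2 → ℝ}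
    (hα : α ∈ Theta) (hr : 0 < r) : ∃ ε > 0, ∀ a ∈ Theta,
      |failProb w t a - failProb w t α| < ε → |failProb w' t a - failProb w' t α| < ε →
        dist a α < r := by
  -- The complementary log-log transform turns the failure probability at temperature `v` into `log
  -- α₀ + α₁ v`. Then `Φ` solves the two affine equations at `w` and `w'`, a left inverse continuous
  -- at the true pair.
  set L : ℝ → ℝ := fun p => Real.log (-Real.log (1 - p) / t) with hLdef
  set Φ : ℝ × ℝ → Fin 2 → ℝ := fun q =>
    ![Real.exp (L q.1 - (L q.1 - L q.2) / (w - w') * w), (L q.1 - L q.2) / (w - w')] with hΦ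
  have hL : ∀ v, ∀ a ∈ Theta, L (failProb v t a) = Real.log (a 0) + a 1 * v := by
    intro v a ha
    have ha0 : a 0 ≠ 0 := ne_of_gt ha
    rw [hLdef]
    simp only [failProb, sub_sub_cancel, Real.log_exp, neg_neg]
    rw [mul_div_cancel_right₀ _ ht.ne', rate, Real.log_mul ha0 (Real.exp_ne_zero _), Real.log_exp]
  have hΦa : ∀ a ∈ Theta, Φ (failProb w t a, failProb w' t a) = a := by
    intro a ha
    have hww : w - w' ≠ 0 := sub_ne_zero.2 hw
    have e1 : (L (failProb w t a) - L (failProb w' t a)) / (w - w') = a 1 := by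
      rw [hL w a ha, hL w' a ha]; field_simp; ring
    rw [hΦ]
    simp only [e1]
    rw [hL w a ha, add_sub_cancel_right, Real.exp_log ha]
    ext k
    fin_cases k <;> rfl
  have hLc : ∀ v, ContinuousAt L (failProb v t α) := by
    intro v
    have h := failProb_mem_Ioo (w := v) hα ht
    have h1 : 1 - failProb v t α ≠ 0 := (sub_pos.2 h.2).ne'
    have h2 : -Real.log (1 - failProb v t α) / t ≠ 0 := by
      have := Real.log_neg (sub_pos.2 h.2) (by linarith [h.1])
      exact div_ne_zero (by linarith) ht.ne'
    exact ((((continuousAt_const.sub continuousAt_id).log h1).neg).div_const t).log h2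
  have hΦc : ContinuousAt Φ (failProb w t α, failProb w' t α) := by
    have c1 : ContinuousAt (fun q : ℝ × ℝ => L q.1) (failProb w t α, failProb w' t α) :=
      ContinuousAt.comp (g := L) (f := Prod.fst) (hLc w) continuousAt_fst
    have c2 : ContinuousAt (fun q : ℝ × ℝ => L q.2) (failProb w t α, failProb w' t α) :=
      ContinuousAt.comp (g := L) (f := Prod.snd) (hLc w') continuousAt_snd
    have c3 := (c1.sub c2).div_const (w - w')
    refine continuousAt_pi.2 fun k => ?_
    fin_cases k
    · exact (c1.sub (c3.mul_const w)).rexp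
    · exact c3
  obtain ⟨ε, hε, h⟩ := Metric.continuousAt_iff.1 hΦc r hr
  refine ⟨ε, hε, fun a ha h1 h2 => ?_⟩
  have h3 := h (x := (failProb w t a, failProb w' t a))
    (by rw [Prod.dist_eq]; exact max_lt h1 h2)
  rwa [hΦa a ha, hΦa α hα] at h3

/-! ### The full objective: estimating equation, existence and consistency of minimizers. -/

variable {I J : ℕ}

/-- The objective function, up to the factor `1 / (I J)`, as a function of the relative frequencies
of failure. -/
noncomputable def freqObj (β : ℝ) (w : Fin I → ℝ) (t : Fin J → ℝ) (x : Fin I × Fin J → ℝ)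
    (a : Fin 2 → ℝ) : ℝ :=
  ∑ c, cellObj β (x c) (failProb (w c.1) (t c.2) a)

theorem hasFDerivAt_freqObj {β : ℝ} (hβ : 0 ≤ β) {w : Fin I → ℝ} {t : Fin J → ℝ}
    (ht : ∀ j, 0 < t j) (x : Fin I × Fin J → ℝ) {a : Fin 2 → ℝ} (ha : a ∈ Theta) :
    HasFDerivAt (freqObj β w t x) (dotCLM ((β + 1) • ∑ c, (failProb (w c.1) (t c.2) a - x c) •
      score β (w c.1) (t c.2) a)) a := by
  have h : HasFDerivAt (freqObj β w t x) (∑ c, ((β + 1) * (weight β (failProb (w c.1) (t c.2) a) *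
      (failProb (w c.1) (t c.2) a - x c))) • dotCLM (grad (w c.1) (t c.2) a)) a :=
    HasFDerivAt.fun_sum fun c _ =>
      (hasDerivAt_cellObj hβ (failProb_mem_Ioo ha (ht c.2))).comp_hasFDerivAt a
        (hasFDerivAt_failProb ha)
  refine h.congr_fderiv ?_
  ext1 r
  rw [dotCLM_apply, smul_dotProduct, sum_dotProduct, sum_apply, Finset.smul_sum]
  refine Finset.sum_congr rfl fun c _ => ?_
  simp only [smul_apply, dotCLM_apply, score, smul_dotProduct, smul_eq_mul]
  ring

/-- The estimating equation satisfied by the minimizers. -/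
theorem estimatingEquation {β : ℝ} (hβ : 0 ≤ β) {w : Fin I → ℝ} {t : Fin J → ℝ}
    (ht : ∀ j, 0 < t j) {x : Fin I × Fin J → ℝ} {a : Fin 2 → ℝ} (ha : a ∈ Theta)
    (hmin : ∀ b ∈ Theta, freqObj β w t x a ≤ freqObj β w t x b) :
    ∑ c, (failProb (w c.1) (t c.2) a - x c) • score β (w c.1) (t c.2) a = 0 := by
  have hloc : IsLocalMin (freqObj β w t x) a := by
    filter_upwards [isOpen_Theta.mem_nhds ha] with b hb using hmin b hb
  have h := hloc.hasFDerivAt_eq_zero (hasFDerivAt_freqObj hβ ht x ha)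
  have h1 : ∀ g, dotCLM g = 0 → g = 0 := by
    intro g hg
    rw [← dotProduct_self_eq_zero, ← dotCLM_apply, hg]
    rfl
  have h2 := h1 _ h
  rcases smul_eq_zero.1 h2 with h3 | h3
  · linarith
  · exact h3

/-- Relative frequencies close to the true failure probabilities make the objective function larger
away from the true parameter than at the true parameter. -/
theorem eventually_freqObj_lt {β : ℝ} (hβ : 0 ≤ β) (hJ : 0 < J) {w : Fin I → ℝ}
    (hw : ∃ i i', w i ≠ w i') {t : Fin J → ℝ} (ht : ∀ j, 0 < t j) {α : Fin 2 → ℝ} (hα : α ∈ Theta)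
    {r : ℝ} (hr : 0 < r) {T : Type*} {l : Filter T} {x : T → Fin I × Fin J → ℝ}
    (hx : ∀ τ c, x τ c ∈ Set.Icc (0 : ℝ) 1)
    (hlim : ∀ c, Tendsto (fun τ => x τ c) l (𝓝 (failProb (w c.1) (t c.2) α))) :
    ∀ᶠ τ in l, ∀ a ∈ Theta, r ≤ dist a α → freqObj β w t (x τ) α < freqObj β w t (x τ) a := by
  obtain ⟨i, i', hne⟩ := hw
  obtain ⟨ε, hε, hsep⟩ := exists_dist_lt_of_failProb hne (ht ⟨0, hJ⟩) hα hr
  have hcell : ∀ c : Fin I × Fin J, ∃ δ > 0, ∀ x ∈ Set.Icc (0 : ℝ) 1, ∀ p ∈ Set.Ioo (0 : ℝ) 1,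
      |x - failProb (w c.1) (t c.2) α| ≤ ε / 2 → ε ≤ |p - failProb (w c.1) (t c.2) α| →
        δ ≤ cellObj β x p - cellObj β x x := fun c => exists_le_cellObj_sub hβ hε
  choose δ hδ hcell using hcell
  have hsmall : Tendsto (fun τ => ∑ c : Fin I × Fin J,
      (cellObj β (x τ c) (failProb (w c.1) (t c.2) α) - cellObj β (x τ c) (x τ c))) l (𝓝 0) := by
    have := tendsto_finsetSum (Finset.univ : Finset (Fin I × Fin J)) fun c _ =>
      (tendsto_cellObj_sub_self β (failProb_mem_Ioo (w := w c.1) hα (ht c.2))).comp (hlim c)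
    simpa using this
  have hclose : ∀ᶠ τ in l, ∀ c, |x τ c - failProb (w c.1) (t c.2) α| ≤ ε / 2 :=
    eventually_all.2 fun c => (hlim c).eventually
      (Metric.closedBall_mem_nhds _ (half_pos hε))
  filter_upwards [hclose, hsmall.eventually (gt_mem_nhds (hδ (i, ⟨0, hJ⟩))),
    hsmall.eventually (gt_mem_nhds (hδ (i', ⟨0, hJ⟩)))] with τ h1 h2 h3 a ha hra
  have hnonneg : ∀ c : Fin I × Fin J,
      0 ≤ cellObj β (x τ c) (failProb (w c.1) (t c.2) a) - cellObj β (x τ c) (x τ c) := fun c =>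
    (cellGap_nonneg hβ (hx τ c) (Set.Ioo_subset_Icc_self (failProb_mem_Ioo ha (ht c.2)))).trans
      (cellGap_le hβ (hx τ c) (failProb_mem_Ioo ha (ht c.2)))
  -- A parameter at distance at least `r` must miss by `ε` in one of the two identifying cells. That
  -- cell alone costs `δ c`, more than the total excess at the truth.
  have hlarge : ∃ c : Fin I × Fin J, (∑ c : Fin I × Fin J,
      (cellObj β (x τ c) (failProb (w c.1) (t c.2) α) - cellObj β (x τ c) (x τ c))) < δ c ∧
      ε ≤ |failProb (w c.1) (t c.2) a - failProb (w c.1) (t c.2) α| := by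
    by_contra! hcon
    exact (hsep a ha (hcon (i, ⟨0, hJ⟩) h2) (hcon (i', ⟨0, hJ⟩) h3)).not_ge hra
  obtain ⟨c, hc1, hc2⟩ := hlarge
  have h4 := hcell c (x τ c) (hx τ c) _ (failProb_mem_Ioo ha (ht c.2)) (h1 c) hc2
  have h5 := Finset.single_le_sum (f := fun c : Fin I × Fin J =>
    cellObj β (x τ c) (failProb (w c.1) (t c.2) a) - cellObj β (x τ c) (x τ c))
    (fun c _ => hnonneg c) (Finset.mem_univ c)
  have h6 := hc1.trans_le (h4.trans h5)
  -- The terms `cellObj β x x` do not depend on the parameter and cancel.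
  simp only [Finset.sum_sub_distrib] at h6
  exact (sub_lt_sub_iff_right _).1 h6

/-- `Theta` is not compact, so the minimum is taken over a closed ball around the truth inside
`Theta`; parameters outside the ball already lose to its centre. -/
theorem eventually_exists_minimizer {β : ℝ} (hβ : 0 ≤ β) (hJ : 0 < J) {w : Fin I → ℝ}
    (hw : ∃ i i', w i ≠ w i') {t : Fin J → ℝ} (ht : ∀ j, 0 < t j) {α : Fin 2 → ℝ} (hα : α ∈ Theta)
    {T : Type*} {l : Filter T} {x : T → Fin I × Fin J → ℝ}
    (hx : ∀ τ c, x τ c ∈ Set.Icc (0 : ℝ) 1)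
    (hlim : ∀ c, Tendsto (fun τ => x τ c) l (𝓝 (failProb (w c.1) (t c.2) α))) :
    ∀ᶠ τ in l, ∃ a ∈ Theta, ∀ b ∈ Theta, freqObj β w t (x τ) a ≤ freqObj β w t (x τ) b := by
  obtain ⟨r, hr, hball⟩ := Metric.nhds_basis_closedBall.mem_iff.1 (isOpen_Theta.mem_nhds hα)
  filter_upwards [eventually_freqObj_lt hβ hJ hw ht hα hr hx hlim] with τ hτ
  obtain ⟨a, ha, hmin⟩ := (isCompact_closedBall α r).exists_isMinOn
    ⟨α, Metric.mem_closedBall_self hr.le⟩ (f := freqObj β w t (x τ)) fun a ha =>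
      (hasFDerivAt_freqObj hβ ht (x τ) (hball ha)).continuousAt.continuousWithinAt
  refine ⟨a, hball ha, fun b hb => ?_⟩
  by_cases h : b ∈ Metric.closedBall α r
  · exact hmin h
  · exact (hmin (Metric.mem_closedBall_self hr.le)).trans
      (hτ b hb (not_le.1 h).le).le

theorem tendsto_minimizer {β : ℝ} (hβ : 0 ≤ β) (hJ : 0 < J) {w : Fin I → ℝ}
    (hw : ∃ i i', w i ≠ w i') {t : Fin J → ℝ} (ht : ∀ j, 0 < t j) {α : Fin 2 → ℝ} (hα : α ∈ Theta)
    {T : Type*} {l : Filter T} {x : T → Fin I × Fin J → ℝ}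
    (hx : ∀ τ c, x τ c ∈ Set.Icc (0 : ℝ) 1)
    (hlim : ∀ c, Tendsto (fun τ => x τ c) l (𝓝 (failProb (w c.1) (t c.2) α))) {a : T → Fin 2 → ℝ}
    (ha : ∀ᶠ τ in l, a τ ∈ Theta ∧ ∀ b ∈ Theta, freqObj β w t (x τ) (a τ) ≤ freqObj β w t (x τ) b) :
    Tendsto a l (𝓝 α) := by
  rw [Metric.tendsto_nhds]
  intro r hr
  filter_upwards [ha, eventually_freqObj_lt hβ hJ hw ht hα hr hx hlim] with τ h1 h2
  by_contra! h3
  exact (h2 _ h1.1 h3).not_ge (h1.2 α hα)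

/-- For outcomes in `{0, 1}` the power term of `V` is affine in the outcome, so averaging over the
devices leaves only the frequency. -/
theorem objective_eq {β : ℝ} (w : Fin I → ℝ) (t : Fin J → ℝ) {K : ℕ} (hK : 0 < K)
    {y : Fin I → Fin J → ℕ → ℕ} (hy : ∀ i j k, y i j k = 0 ∨ y i j k = 1) {a : Fin 2 → ℝ} :
    objective β w t K y a = 1 / ((I : ℝ) * J) *
      freqObj β w t (fun c => (∑ k ∈ Finset.range K, (y c.1 c.2 k : ℝ)) / K) a := by
  have hK' : (K : ℝ) ≠ 0 := by positivity
  rw [objective, freqObj]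
  split_ifs with h0
  · rw [dKL, Fintype.sum_prod_type]
    congr 1
    refine Finset.sum_congr rfl fun i _ => Finset.sum_congr rfl fun j _ => ?_
    rw [cellObj, if_pos h0, failures]
    push_cast
    congr 2
    · rw [div_mul_eq_div_div]
    · field_simp
    · congr 1
      field_simp
  · rw [Fintype.sum_prod_type, ← div_div, div_mul_eq_mul_div, mul_div_assoc, Finset.sum_div]
    congr 1
    refine Finset.sum_congr rfl fun i _ => ?_
    rw [Finset.sum_div]
    refine Finset.sum_congr rfl fun j _ => ?_
    rw [cellObj, if_neg h0]
    have hV : ∀ k, V β (w i) (t j) (y i j k) a = failProb (w i) (t j) a ^ (β + 1)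
        + (1 - failProb (w i) (t j) a) ^ (β + 1) - (1 + β) / β *
          ((y i j k : ℝ) * failProb (w i) (t j) a ^ β
            + (1 - (y i j k : ℝ)) * (1 - failProb (w i) (t j) a) ^ β) := by
      intro k
      rcases hy i j k with h | h <;> simp [V, h]
    simp_rw [hV]
    rw [Finset.sum_sub_distrib, ← Finset.mul_sum, Finset.sum_add_distrib, Finset.sum_add_distrib,
      ← Finset.sum_mul, ← Finset.sum_mul, Finset.sum_sub_distrib]
    simp only [Finset.sum_const, Finset.card_range, nsmul_eq_mul, mul_one]
    field_simp

theorem isMDPDE_iff {β : ℝ} (hI : 0 < I) (hJ : 0 < J) {w : Fin I → ℝ} {t : Fin J → ℝ} {K : ℕ}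
    (hK : 0 < K) {y : Fin I → Fin J → ℕ → ℕ} (hy : ∀ i j k, y i j k = 0 ∨ y i j k = 1)
    {a : Fin 2 → ℝ} :
    IsMDPDE β w t K y a ↔ a ∈ Theta ∧ ∀ b ∈ Theta,
      freqObj β w t (fun c => (∑ k ∈ Finset.range K, (y c.1 c.2 k : ℝ)) / K) a ≤
        freqObj β w t (fun c => (∑ k ∈ Finset.range K, (y c.1 c.2 k : ℝ)) / K) b := by
  have h : (0 : ℝ) < 1 / ((I : ℝ) * J) := by positivity
  simp only [IsMDPDE, objective_eq w t hK hy, mul_le_mul_iff_right₀ h]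

end OneShot

/-! ### The matrices `Jbar` and `Kbar` and the asymptotic variance. -/

namespace OneShot

open scoped Topology Matrix

/-- `W` has rank one, so the quadratic forms below become weighted sums of squares. -/
theorem W_apply (w : ℝ) (α : Fin 2 → ℝ) (k l : Fin 2) : W w α k l = dir w α k * dir w α l := by
  fin_cases k <;> fin_cases l <;> simp [W, dir] <;> ring

theorem W_mulVec (w : ℝ) (α r : Fin 2 → ℝ) : W w α *ᵥ r = (dir w α ⬝ᵥ r) • dir w α := by
  ext k
  simp only [Matrix.mulVec, dotProduct, W_apply, Fin.sum_univ_two, Pi.smul_apply, smul_eq_mul]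
  ring

theorem W_transpose (w : ℝ) (α : Fin 2 → ℝ) : (W w α)ᵀ = W w α := by
  ext k l
  rw [Matrix.transpose_apply, W_apply, W_apply, mul_comm]

theorem sum_smul_W_mulVec {I : ℕ} (s : Fin I → ℝ) (w : Fin I → ℝ) (α r : Fin 2 → ℝ) :
    (∑ i, s i • W (w i) α) *ᵥ r = ∑ i, (s i * (dir (w i) α ⬝ᵥ r)) • dir (w i) α := by
  rw [Matrix.sum_mulVec]
  simp_rw [Matrix.smul_mulVec, W_mulVec, smul_smul]

theorem sum_smul_W_transpose {I : ℕ} (s : Fin I → ℝ) (w : Fin I → ℝ) (α : Fin 2 → ℝ) :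
    (∑ i, s i • W (w i) α)ᵀ = ∑ i, s i • W (w i) α := by
  simp_rw [Matrix.transpose_sum, Matrix.transpose_smul, W_transpose]

theorem dotProduct_sum_smul_W_mulVec {I : ℕ} (s : Fin I → ℝ) (w : Fin I → ℝ) (α r : Fin 2 → ℝ) :
    r ⬝ᵥ ((∑ i, s i • W (w i) α) *ᵥ r) = ∑ i, s i * (dir (w i) α ⬝ᵥ r) ^ 2 := by
  rw [sum_smul_W_mulVec, dotProduct_sum]
  refine Finset.sum_congr rfl fun i _ => ?_
  rw [dotProduct_smul, dotProduct_comm r, smul_eq_mul]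
  ring

/-- Two distinct temperatures give linearly independent directions `(1 / α₀, w)`, so no nonzero
vector is orthogonal to all of them. -/
theorem dotProduct_sum_smul_W_mulVec_pos {I : ℕ} {s : Fin I → ℝ} (hs : ∀ i, 0 < s i)
    {w : Fin I → ℝ} (hw : ∃ i i', w i ≠ w i') {α : Fin 2 → ℝ} (hα : α ∈ Theta) {r : Fin 2 → ℝ}
    (hr : r ≠ 0) : 0 < r ⬝ᵥ ((∑ i, s i • W (w i) α) *ᵥ r) := by
  rw [dotProduct_sum_smul_W_mulVec]
  have hnn : ∀ i ∈ Finset.univ, 0 ≤ s i * (dir (w i) α ⬝ᵥ r) ^ 2 := fun i _ =>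
    mul_nonneg (hs i).le (sq_nonneg _)
  refine lt_of_le_of_ne (Finset.sum_nonneg hnn) fun h => hr ?_
  rw [eq_comm, Finset.sum_eq_zero_iff_of_nonneg hnn] at h
  have hz : ∀ i, 1 / α 0 * r 0 + w i * r 1 = 0 := fun i => by
    have := h i (Finset.mem_univ i)
    simpa [(hs i).ne', dir, dotProduct, Fin.sum_univ_two] using this
  obtain ⟨i, i', hne⟩ := hw
  have h1 : r 1 = 0 := by
    have h2 : (w i - w i') * r 1 = 0 := by linear_combination hz i - hz i'
    exact (mul_eq_zero.1 h2).resolve_left (sub_ne_zero.2 hne)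
  have h0 : r 0 = 0 := by
    have h2 := hz i
    rw [h1, mul_zero, add_zero] at h2
    exact (mul_eq_zero.1 h2).resolve_left (one_div_ne_zero (ne_of_gt hα))
  ext k
  fin_cases k
  · exact h0
  · exact h1

theorem isUnit_det_sum_smul_W {I : ℕ} {s : Fin I → ℝ} (hs : ∀ i, 0 < s i)
    {w : Fin I → ℝ} (hw : ∃ i i', w i ≠ w i') {α : Fin 2 → ℝ} (hα : α ∈ Theta) :
    IsUnit (∑ i, s i • W (w i) α).det := by
  rw [isUnit_iff_ne_zero]
  intro h
  obtain ⟨r, hr, h0⟩ := Matrix.exists_mulVec_eq_zero_iff.2 h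
  have := dotProduct_sum_smul_W_mulVec_pos hs hw hα hr
  rw [h0, dotProduct_zero] at this
  exact this.false

theorem weight_pos {β p : ℝ} (hp : p ∈ Set.Ioo (0 : ℝ) 1) : 0 < weight β p :=
  add_pos (Real.rpow_pos_of_pos hp.1 _) (Real.rpow_pos_of_pos (sub_pos.2 hp.2) _)

/-- With `q = 1 - p`, `A = p ^ (β - 1)` and `B = q ^ (β - 1)`, this reads `A²p + B²q - (Ap - Bq)² =
(A + B)²pq`. It identifies the braces in `Kbar` as the squared weight times a Bernoulli variance. -/
theorem weight_sq_mul {β p : ℝ} (hp : p ∈ Set.Ioo (0 : ℝ) 1) :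
    p ^ (2 * β - 1) + (1 - p) ^ (2 * β - 1) - (p ^ β - (1 - p) ^ β) ^ 2 =
      weight β p ^ 2 * (p * (1 - p)) := by
  have hq : 0 < 1 - p := sub_pos.2 hp.2
  have key : ∀ x : ℝ, 0 < x → x ^ β = x ^ (β - 1) * x ∧ x ^ (2 * β - 1) = (x ^ (β - 1)) ^ 2 * x := by
    intro x hx
    constructor
    · rw [← Real.rpow_add_one hx.ne']; ring_nf
    · rw [← Real.rpow_natCast, ← Real.rpow_mul hx.le, ← Real.rpow_add_one hx.ne']
      congr 1; push_cast; ring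
  rw [weight, (key p hp.1).1, (key p hp.1).2, (key _ hq).1, (key _ hq).2]
  ring

theorem dens_pos {w t : ℝ} {α : Fin 2 → ℝ} (hα : α ∈ Theta) : 0 < dens w t α :=
  mul_pos (rate_pos hα) (Real.exp_pos _)

variable {I J : ℕ}

theorem Kbar_eq {β : ℝ} {w : Fin I → ℝ} {t : Fin J → ℝ} (ht : ∀ j, 0 < t j) {α : Fin 2 → ℝ}
    (hα : α ∈ Theta) : Kbar β w t α = ∑ i, (∑ j, t j ^ 2 * dens (w i) (t j) α ^ 2 *
      (weight β (failProb (w i) (t j) α) ^ 2 *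
        (failProb (w i) (t j) α * (1 - failProb (w i) (t j) α)))) • W (w i) α := by
  refine Finset.sum_congr rfl fun i _ => ?_
  congr 1
  refine Finset.sum_congr rfl fun j _ => ?_
  rw [weight_sq_mul (failProb_mem_Ioo hα (ht j))]

theorem Jbar_coeff_pos (β : ℝ) (hJ : 0 < J) (w : Fin I → ℝ) {t : Fin J → ℝ} (ht : ∀ j, 0 < t j)
    {α : Fin 2 → ℝ} (hα : α ∈ Theta) (i : Fin I) : 0 < ∑ j, t j ^ 2 * dens (w i) (t j) α ^ 2 *
      (failProb (w i) (t j) α ^ (β - 1) + (1 - failProb (w i) (t j) α) ^ (β - 1)) := by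
  refine Finset.sum_pos (fun j _ => ?_) ⟨⟨0, hJ⟩, Finset.mem_univ _⟩
  have h1 := ht j
  have h2 := dens_pos (w := w i) (t := t j) hα
  have h3 : 0 < failProb (w i) (t j) α ^ (β - 1) + (1 - failProb (w i) (t j) α) ^ (β - 1) :=
    weight_pos (failProb_mem_Ioo hα (ht j))
  positivity

theorem Kbar_coeff_pos (β : ℝ) (hJ : 0 < J) (w : Fin I → ℝ) {t : Fin J → ℝ} (ht : ∀ j, 0 < t j)
    {α : Fin 2 → ℝ} (hα : α ∈ Theta) (i : Fin I) : 0 < ∑ j, t j ^ 2 * dens (w i) (t j) α ^ 2 *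
      (weight β (failProb (w i) (t j) α) ^ 2 *
        (failProb (w i) (t j) α * (1 - failProb (w i) (t j) α))) := by
  refine Finset.sum_pos (fun j _ => ?_) ⟨⟨0, hJ⟩, Finset.mem_univ _⟩
  have h1 := ht j
  have h2 := dens_pos (w := w i) (t := t j) hα
  have hp := failProb_mem_Ioo (w := w i) hα (ht j)
  have h3 := weight_pos (β := β) hp
  have h4 := mul_pos hp.1 (sub_pos.2 hp.2)
  positivity

theorem isUnit_det_Jbar (β : ℝ) (hJ : 0 < J) {w : Fin I → ℝ} (hw : ∃ i i', w i ≠ w i')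
    {t : Fin J → ℝ} (ht : ∀ j, 0 < t j) {α : Fin 2 → ℝ} (hα : α ∈ Theta) :
    IsUnit (Jbar β w t α).det :=
  isUnit_det_sum_smul_W (Jbar_coeff_pos β hJ w ht hα) hw hα

/-- This exhibits `Jbar` as the linear part of the estimating equation, which its inverse must undo.
-/
theorem Jbar_mulVec (β : ℝ) (w : Fin I → ℝ) (t : Fin J → ℝ) (α r : Fin 2 → ℝ) :
    Jbar β w t α *ᵥ r = ∑ c : Fin I × Fin J,
      (grad (w c.1) (t c.2) α ⬝ᵥ r) • score β (w c.1) (t c.2) α := by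
  rw [Jbar, sum_smul_W_mulVec, Fintype.sum_prod_type]
  refine Finset.sum_congr rfl fun i _ => ?_
  rw [Finset.sum_mul, Finset.sum_smul]
  refine Finset.sum_congr rfl fun j _ => ?_
  rw [score, grad, smul_smul, smul_smul, smul_dotProduct, smul_eq_mul, weight]
  congr 1
  ring

/-- The asymptotic variance `mᵀ J̄⁻¹ K̄ J̄⁻¹ m` of the contrast `mᵀ α̂`. -/
noncomputable def asympVar (β : ℝ) (w : Fin I → ℝ) (t : Fin J → ℝ) (m a : Fin 2 → ℝ) : ℝ :=
  m ⬝ᵥ (((Jbar β w t a)⁻¹ * Kbar β w t a * (Jbar β w t a)⁻¹) *ᵥ m)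

/-- The coefficient of a cell in the linearization of the contrast `mᵀ α̂`. -/
noncomputable def influence (β : ℝ) (w : Fin I → ℝ) (t : Fin J → ℝ) (m a : Fin 2 → ℝ)
    (c : Fin I × Fin J) : ℝ :=
  m ⬝ᵥ ((Jbar β w t a)⁻¹ *ᵥ score β (w c.1) (t c.2) a)

theorem dotProduct_Jbar_inv_mulVec (β : ℝ) (w : Fin I → ℝ) (t : Fin J → ℝ) (m a r : Fin 2 → ℝ) :
    m ⬝ᵥ ((Jbar β w t a)⁻¹ *ᵥ r) = ((Jbar β w t a)⁻¹ *ᵥ m) ⬝ᵥ r := by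
  have h : ((Jbar β w t a)⁻¹)ᵀ = (Jbar β w t a)⁻¹ := by
    rw [Matrix.transpose_nonsing_inv, Jbar, sum_smul_W_transpose]
  rw [Matrix.dotProduct_mulVec, ← Matrix.mulVec_transpose, h]

theorem asympVar_eq_dotProduct (β : ℝ) (w : Fin I → ℝ) (t : Fin J → ℝ) (m a : Fin 2 → ℝ) :
    asympVar β w t m a =
      ((Jbar β w t a)⁻¹ *ᵥ m) ⬝ᵥ (Kbar β w t a *ᵥ ((Jbar β w t a)⁻¹ *ᵥ m)) := by
  rw [asympVar, ← Matrix.mulVec_mulVec, ← Matrix.mulVec_mulVec, dotProduct_Jbar_inv_mulVec]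

/-- Symmetry of `Jbar⁻¹` moves it onto `m`, and the form of `Kbar` splits over the cells. The right
side is the variance supplied by the central limit theorem. -/
theorem asympVar_eq_sum {β : ℝ} {w : Fin I → ℝ} {t : Fin J → ℝ} (ht : ∀ j, 0 < t j)
    (m : Fin 2 → ℝ) {α : Fin 2 → ℝ} (hα : α ∈ Theta) :
    asympVar β w t m α = ∑ c : Fin I × Fin J, influence β w t m α c ^ 2 *
      (failProb (w c.1) (t c.2) α * (1 - failProb (w c.1) (t c.2) α)) := by
  rw [asympVar_eq_dotProduct, Kbar_eq ht hα, dotProduct_sum_smul_W_mulVec, Fintype.sum_prod_type]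
  refine Finset.sum_congr rfl fun i _ => ?_
  rw [Finset.sum_mul]
  refine Finset.sum_congr rfl fun j _ => ?_
  rw [influence, dotProduct_Jbar_inv_mulVec β w t m, score, grad, dotProduct_smul, dotProduct_smul,
    dotProduct_comm (dir _ _), smul_eq_mul, smul_eq_mul]
  ring

theorem asympVar_pos (β : ℝ) (hJ : 0 < J) {w : Fin I → ℝ} (hw : ∃ i i', w i ≠ w i')
    {t : Fin J → ℝ} (ht : ∀ j, 0 < t j) {m : Fin 2 → ℝ} (hm : m ≠ 0) {α : Fin 2 → ℝ}
    (hα : α ∈ Theta) : 0 < asympVar β w t m α := by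
  rw [asympVar_eq_dotProduct, Kbar_eq ht hα]
  refine dotProduct_sum_smul_W_mulVec_pos (Kbar_coeff_pos β hJ w ht hα) hw hα fun h => hm ?_
  rw [← Matrix.one_mulVec m, ← Matrix.mul_nonsing_inv _ (isUnit_det_Jbar β hJ hw ht hα),
    ← Matrix.mulVec_mulVec, h, Matrix.mulVec_zero]

theorem continuousAt_W (w : ℝ) {α : Fin 2 → ℝ} (hα : α ∈ Theta) : ContinuousAt (W w) α := by
  have h := continuousAt_dir w hα
  refine continuousAt_pi.2 fun k => continuousAt_pi.2 fun l => ?_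
  simp_rw [W_apply]
  exact (continuousAt_pi.1 h k).mul (continuousAt_pi.1 h l)

theorem continuousAt_Jbar (β : ℝ) (w : Fin I → ℝ) {t : Fin J → ℝ} (ht : ∀ j, 0 < t j)
    {α : Fin 2 → ℝ} (hα : α ∈ Theta) : ContinuousAt (Jbar β w t) α :=
  tendsto_finsetSum _ fun _ _ => ContinuousAt.smul (tendsto_finsetSum _ fun j _ =>
    (continuousAt_const.mul ((continuous_dens _ _).continuousAt.pow 2)).mul
      ((continuousAt_failProb_rpow (ht j) hα _).add
        (continuousAt_one_sub_failProb_rpow (ht j) hα _))) (continuousAt_W _ hα)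

theorem continuousAt_Kbar (β : ℝ) (w : Fin I → ℝ) {t : Fin J → ℝ} (ht : ∀ j, 0 < t j)
    {α : Fin 2 → ℝ} (hα : α ∈ Theta) : ContinuousAt (Kbar β w t) α :=
  tendsto_finsetSum _ fun _ _ => ContinuousAt.smul (tendsto_finsetSum _ fun j _ =>
    (continuousAt_const.mul ((continuous_dens _ _).continuousAt.pow 2)).mul
      (((continuousAt_failProb_rpow (ht j) hα _).add
        (continuousAt_one_sub_failProb_rpow (ht j) hα _)).sub
        (((continuousAt_failProb_rpow (ht j) hα _).sub
          (continuousAt_one_sub_failProb_rpow (ht j) hα _)).pow 2))) (continuousAt_W _ hα)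

/-- Apart from `det⁻¹`, this is polynomial in the matrix entries. It also holds for singular `Jbar`,
both sides being zero, which gives measurability on the whole plane; the estimator may leave `Theta`
when no minimizer exists. -/
theorem asympVar_eq_adjugate (β : ℝ) (w : Fin I → ℝ) (t : Fin J → ℝ) (m a : Fin 2 → ℝ) :
    asympVar β w t m a = (Jbar β w t a).det⁻¹ ^ 2 *
      (m ⬝ᵥ (((Jbar β w t a).adjugate * Kbar β w t a * (Jbar β w t a).adjugate) *ᵥ m)) := by
  rw [asympVar, Matrix.inv_def, Ring.inverse_eq_inv', Matrix.smul_mul, Matrix.smul_mul,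
    Matrix.mul_smul, smul_smul, Matrix.smul_mulVec, dotProduct_smul, smul_eq_mul, sq]

theorem continuousAt_asympVar (β : ℝ) (hJ : 0 < J) {w : Fin I → ℝ} (hw : ∃ i i', w i ≠ w i')
    {t : Fin J → ℝ} (ht : ∀ j, 0 < t j) (m : Fin 2 → ℝ) {α : Fin 2 → ℝ} (hα : α ∈ Theta) :
    ContinuousAt (asympVar β w t m) α := by
  have hdet : (Jbar β w t α).det ≠ 0 := (isUnit_det_Jbar β hJ hw ht hα).ne_zero
  have h1 := continuousAt_Jbar β w ht hα
  have h2 := continuousAt_Kbar β w ht hα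
  have c1 : Continuous fun A : Matrix (Fin 2) (Fin 2) ℝ => A.det := continuous_id.matrix_det
  have c2 : Continuous fun q : Matrix (Fin 2) (Fin 2) ℝ × Matrix (Fin 2) (Fin 2) ℝ =>
      m ⬝ᵥ ((q.1.adjugate * q.2 * q.1.adjugate) *ᵥ m) :=
    continuous_const.dotProduct
      (((continuous_fst.matrix_adjugate.matrix_mul continuous_snd).matrix_mul
        continuous_fst.matrix_adjugate).matrix_mulVec continuous_const)
  have h : asympVar β w t m = fun a => (Jbar β w t a).det⁻¹ ^ 2 *
      (m ⬝ᵥ (((Jbar β w t a).adjugate * Kbar β w t a * (Jbar β w t a).adjugate) *ᵥ m)) :=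
    funext fun a => asympVar_eq_adjugate β w t m a
  rw [h]
  exact (((c1.continuousAt.comp h1).inv₀ hdet).pow 2).mul
    (ContinuousAt.comp (g := fun q : Matrix (Fin 2) (Fin 2) ℝ × Matrix (Fin 2) (Fin 2) ℝ =>
      m ⬝ᵥ ((q.1.adjugate * q.2 * q.1.adjugate) *ᵥ m))
      (f := fun a => (Jbar β w t a, Kbar β w t a)) c2.continuousAt (h1.prodMk h2))

theorem measurable_dir_apply (w : ℝ) (k : Fin 2) : Measurable fun a => dir w a k := by
  fin_cases k
  · exact measurable_const.div (measurable_pi_apply 0)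
  · exact measurable_const

theorem measurable_Jbar_apply (β : ℝ) (w : Fin I → ℝ) (t : Fin J → ℝ) (k l : Fin 2) :
    Measurable fun a => Jbar β w t a k l := by
  have h1 : ∀ i j, Measurable (failProb (w i) (t j)) := fun i j =>
    (continuous_failProb _ _).measurable
  have h2 : ∀ i j, Measurable (dens (w i) (t j)) := fun i j => (continuous_dens _ _).measurable
  have h3 : ∀ i k, Measurable fun a => dir (w i) a k := fun i k => measurable_dir_apply _ _
  simp only [Jbar, Matrix.sum_apply, Matrix.smul_apply, W_apply, smul_eq_mul]
  fun_prop

theorem measurable_Kbar_apply (β : ℝ) (w : Fin I → ℝ) (t : Fin J → ℝ) (k l : Fin 2) :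
    Measurable fun a => Kbar β w t a k l := by
  have h1 : ∀ i j, Measurable (failProb (w i) (t j)) := fun i j =>
    (continuous_failProb _ _).measurable
  have h2 : ∀ i j, Measurable (dens (w i) (t j)) := fun i j => (continuous_dens _ _).measurable
  have h3 : ∀ i k, Measurable fun a => dir (w i) a k := fun i k => measurable_dir_apply _ _
  simp only [Kbar, Matrix.sum_apply, Matrix.smul_apply, W_apply, smul_eq_mul]
  fun_prop

theorem measurable_asympVar (β : ℝ) (w : Fin I → ℝ) (t : Fin J → ℝ) (m : Fin 2 → ℝ) :
    Measurable (asympVar β w t m) := by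
  have h1 := measurable_Jbar_apply β w t
  have h2 := measurable_Kbar_apply β w t
  rw [show asympVar β w t m = _ from funext fun a => asympVar_eq_adjugate β w t m a]
  simp only [Matrix.det_fin_two, Matrix.adjugate_fin_two, dotProduct, Matrix.mulVec,
    Matrix.mul_apply, Fin.sum_univ_two, Matrix.of_apply, Matrix.cons_val', Matrix.cons_val_zero,
    Matrix.cons_val_one, Matrix.cons_val_fin_one]
  fun_prop

theorem isLittleO_contrast {β : ℝ} (hβ : 0 ≤ β) (hJ : 0 < J) {w : Fin I → ℝ}
    (hw : ∃ i i', w i ≠ w i') {t : Fin J → ℝ} (ht : ∀ j, 0 < t j) (m : Fin 2 → ℝ) {α : Fin 2 → ℝ}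
    (hα : α ∈ Theta) {T : Type*} {l : Filter T} {x : T → Fin I × Fin J → ℝ} {a : T → Fin 2 → ℝ}
    (hlim : Tendsto a l (𝓝 α))
    (ha : ∀ᶠ τ in l, a τ ∈ Theta ∧ ∀ b ∈ Theta, freqObj β w t (x τ) (a τ) ≤ freqObj β w t (x τ) b) :
    (fun τ => m ⬝ᵥ (a τ - α) - ∑ c, influence β w t m α c *
      (x τ c - failProb (w c.1) (t c.2) α)) =o[l]
        fun τ => ∑ c, |x τ c - failProb (w c.1) (t c.2) α| := by
  set B : (Fin 2 → ℝ) →L[ℝ] (Fin 2 → ℝ) :=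
    LinearMap.toContinuousLinearMap (Matrix.mulVecLin (Jbar β w t α)⁻¹) with hBdef
  have hBapp : ∀ r, B r = (Jbar β w t α)⁻¹ *ᵥ r := fun _ => rfl
  have h := isLittleO_of_estimatingEquation (B := B) hlim
    (π := fun c : Fin I × Fin J => failProb (w c.1) (t c.2))
    (u := fun c : Fin I × Fin J => score β (w c.1) (t c.2)) (x := x)
    (fun c => hasFDerivAt_failProb hα) (fun c => continuousAt_score (ht c.2) hα)
    (fun r => by
      simp only [dotCLM_apply]
      rw [← Jbar_mulVec, hBapp, Matrix.mulVec_mulVec,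
        Matrix.nonsing_inv_mul _ (isUnit_det_Jbar β hJ hw ht hα), Matrix.one_mulVec])
    (by
      filter_upwards [ha] with τ hτ using estimatingEquation hβ ht hτ.1 hτ.2)
  refine (((dotCLM m).isBigO_comp _ l).trans_isLittleO h).congr_left fun τ => ?_
  rw [map_sub, dotCLM_apply, dotCLM_apply, map_sum, dotProduct_sum]
  congr 1
  refine Finset.sum_congr rfl fun c _ => ?_
  rw [map_smul, dotProduct_smul, hBapp, influence, smul_eq_mul, mul_comm]

end OneShot

/-! ### Assembly of the limit theorem. -/

theorem hasLaw_sqrt_mul_gaussianReal {v : ℝ} (hv : 0 ≤ v) :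
    HasLaw (fun x : ℝ => √v * x) (gaussianReal 0 v.toNNReal) (gaussianReal 0 1) := by
  have h := gaussianReal_const_mul (HasLaw.id (μ := gaussianReal 0 1)) √v
  convert h using 2
  · simp
  · simp
  · apply NNReal.eq
    simp [Real.sq_sqrt hv, hv]

open scoped Topology in
/-- Almost surely, the estimator is consistent and the contrast `mᵀ α̂` is asymptotically linear in
the relative frequencies of failure. -/
theorem OneShot.ae_consistent_and_isLittleO_contrast {Ω : Type*} [MeasurableSpace Ω] {P : Measure Ω}
    [IsProbabilityMeasure P] {I J : ℕ} (hJ : 0 < J)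
    {w : Fin I → ℝ} (hw : ∃ i i', w i ≠ w i') {t : Fin J → ℝ} (ht : ∀ j, 0 < t j)
    {β : ℝ} (hβ : 0 ≤ β) {α : Fin 2 → ℝ} (hα : α ∈ OneShot.Theta) (m : Fin 2 → ℝ)
    {y : Fin I → Fin J → ℕ → Ω → ℕ}
    (hindep : iIndepFun (fun q : (Fin I × Fin J) × ℕ => fun ω => (y q.1.1 q.1.2 q.2 ω : ℝ)) P)
    (hlaw : ∀ i j k, HasLaw (y i j k)
      (bernoulliMeasure 1 0 ⟨OneShot.failProb (w i) (t j) α, OneShot.failProb_mem hα (ht j)⟩) P)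
    {αhat : ℕ → Ω → Fin 2 → ℝ}
    (hest : ∀ K, 0 < K → ∀ᵐ ω ∂P,
      (∃ a, OneShot.IsMDPDE β w t K (fun i j k => y i j k ω) a) →
        OneShot.IsMDPDE β w t K (fun i j k => y i j k ω) (αhat K ω)) :
    ∀ᵐ ω ∂P, Tendsto (fun K => αhat K ω) atTop (𝓝 α) ∧
      (fun K : ℕ => m ⬝ᵥ (αhat K ω - α) - ∑ c, OneShot.influence β w t m α c *
        ((∑ k ∈ Finset.range K, (y c.1 c.2 k ω : ℝ)) / K - OneShot.failProb (w c.1) (t c.2) α))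
        =o[atTop] fun K : ℕ => ∑ c : Fin I × Fin J,
          |(∑ k ∈ Finset.range K, (y c.1 c.2 k ω : ℝ)) / K - OneShot.failProb (w c.1) (t c.2) α| := by
  have hI : 0 < I := by
    obtain ⟨i, -⟩ := hw
    exact i.pos
  have h01 : ∀ᵐ ω ∂P, ∀ i j k, y i j k ω = 0 ∨ y i j k ω = 1 :=
    ae_all_iff.2 fun i => ae_all_iff.2 fun j => ae_all_iff.2 fun k =>
      ae_eq_zero_or_one_of_hasLaw_bernoulli (hlaw i j k)
  have hfreq : ∀ᵐ ω ∂P, ∀ c : Fin I × Fin J,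
      Tendsto (fun K : ℕ => (∑ k ∈ Finset.range K, (y c.1 c.2 k ω : ℝ)) / K) atTop
        (𝓝 (OneShot.failProb (w c.1) (t c.2) α)) :=
    ae_all_iff.2 fun c => ae_tendsto_freq_of_bernoulli
      (fun k => hasLaw_bernoulli_cast (hlaw c.1 c.2 k))
      (hindep.precomp (Prod.mk_right_injective c))
  have hest' : ∀ᵐ ω ∂P, ∀ K, 0 < K →
      (∃ a, OneShot.IsMDPDE β w t K (fun i j k => y i j k ω) a) →
        OneShot.IsMDPDE β w t K (fun i j k => y i j k ω) (αhat K ω) := by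
    -- One null set serves all the countably many sample sizes.
    refine ae_all_iff.2 fun K => ?_
    by_cases hK : 0 < K
    · filter_upwards [hest K hK] with ω hω _ using hω
    · exact ae_of_all _ fun ω h => absurd h hK
  filter_upwards [h01, hfreq, hest'] with ω h1 h2 h3
  -- This includes `K = 0`, where the quotient is `0`.
  have hx : ∀ (K : ℕ) (c : Fin I × Fin J),
      (∑ k ∈ Finset.range K, (y c.1 c.2 k ω : ℝ)) / K ∈ Set.Icc (0 : ℝ) 1 := by
    intro K c
    refine ⟨by positivity, div_le_one_of_le₀ ?_ K.cast_nonneg⟩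
    calc ∑ k ∈ Finset.range K, (y c.1 c.2 k ω : ℝ) ≤ ∑ k ∈ Finset.range K, (1 : ℝ) := by
          refine Finset.sum_le_sum fun k _ => ?_
          rcases h1 c.1 c.2 k with h | h <;> simp [h]
      _ = K := by simp
  have hmin : ∀ᶠ K in atTop, αhat K ω ∈ OneShot.Theta ∧ ∀ b ∈ OneShot.Theta,
      OneShot.freqObj β w t (fun c => (∑ k ∈ Finset.range K, (y c.1 c.2 k ω : ℝ)) / K) (αhat K ω) ≤
        OneShot.freqObj β w t (fun c => (∑ k ∈ Finset.range K, (y c.1 c.2 k ω : ℝ)) / K) b := by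
    filter_upwards [OneShot.eventually_exists_minimizer hβ hJ hw ht hα hx h2,
      eventually_gt_atTop 0] with K ⟨a, ha⟩ hK
    have hiff := fun a => OneShot.isMDPDE_iff (β := β) hI hJ (w := w) (t := t) hK
      (y := fun i j k => y i j k ω) h1 (a := a)
    exact (hiff _).1 (h3 K hK ⟨a, (hiff a).2 ha⟩)
  have hlim := OneShot.tendsto_minimizer hβ hJ hw ht hα hx h2 hmin
  exact ⟨hlim, OneShot.isLittleO_contrast hβ hJ hw ht m hα hlim hmin⟩

theorem theorem9 {Ω : Type*} [MeasurableSpace Ω] (P : Measure Ω) [IsProbabilityMeasure P]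
    {I J : ℕ} (hJ : 0 < J)
    (w : Fin I → ℝ) (hw : ∃ i i', w i ≠ w i')
    (t : Fin J → ℝ) (ht : ∀ j, 0 < t j)
    (β : ℝ) (hβ : 0 ≤ β)
    (α : Fin 2 → ℝ) (hα : α ∈ OneShot.Theta)
    (m : Fin 2 → ℝ) (hm : m ≠ 0) (d : ℝ) (hH : m ⬝ᵥ α = d)
    (y : Fin I → Fin J → ℕ → Ω → ℕ)
    (hindep : iIndepFun (fun (q : Fin I × Fin J × ℕ) => y q.1 q.2.1 q.2.2) P)
    (hlaw : ∀ i j k, HasLaw (y i j k)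
      (bernoulliMeasure 1 0 ⟨OneShot.failProb (w i) (t j) α, OneShot.failProb_mem hα (ht j)⟩) P)
    (αhat : ℕ → Ω → Fin 2 → ℝ) (hmeas : ∀ K, AEMeasurable (αhat K) P)
    (hest : ∀ K, 0 < K → ∀ᵐ ω ∂P,
      (∃ a, OneShot.IsMDPDE β w t K (fun i j k => y i j k ω) a) →
        OneShot.IsMDPDE β w t K (fun i j k => y i j k ω) (αhat K ω)) :
    TendstoInDistribution (fun (K : ℕ) (ω : Ω) => OneShot.Z β w t m d K (αhat K ω)) atTop
      (id : ℝ → ℝ) (fun _ => P) (gaussianReal 0 1) := by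
  have hindep' : iIndepFun
      (fun q : (Fin I × Fin J) × ℕ => fun ω => (y q.1.1 q.1.2 q.2 ω : ℝ)) P :=
    (hindep.precomp (Equiv.prodAssoc (Fin I) (Fin J) ℕ).injective).comp
      (fun _ n => (n : ℝ)) (fun _ => by fun_prop)
  set p : Fin I × Fin J → unitInterval := fun c =>
    ⟨OneShot.failProb (w c.1) (t c.2) α, OneShot.failProb_mem hα (ht c.2)⟩
  set X : Fin I × Fin J → ℕ → Ω → ℝ := fun c k ω => (y c.1 c.2 k ω : ℝ)
  have hlawX : ∀ c k, HasLaw (X c k) (bernoulliMeasure 1 0 (p c)) P := fun c k =>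
    hasLaw_bernoulli_cast (hlaw c.1 c.2 k)
  have hXm : ∀ c k, AEMeasurable (X c k) P := fun c k => (hlawX c k).aemeasurable
  -- Used with the influence coefficients for the main term, and with unit vectors to control each
  -- cell in the remainder.
  have hclt : ∀ b : Fin I × Fin J → ℝ, TendstoInDistribution
      (fun (K : ℕ) ω => √K * ∑ c, b c * ((∑ k ∈ Finset.range K, X c k ω) / K - p c)) atTop
      (fun x : ℝ => √(∑ c, b c ^ 2 * (p c * (1 - p c))) * x) (fun _ => P) (gaussianReal 0 1) := by
    intro b
    have hnn : 0 ≤ ∑ c, b c ^ 2 * ((p c : ℝ) * (1 - p c)) := Finset.sum_nonneg fun c _ =>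
      mul_nonneg (sq_nonneg _) (mul_nonneg (p c).2.1 (sub_nonneg.2 (p c).2.2))
    refine (tendstoInDistribution_weighted_bernoulli hlawX hindep' b
      (hasLaw_sqrt_mul_gaussianReal hnn)).congr (fun K => ae_of_all _ fun ω => ?_) (ae_eq_refl _)
    rcases K.eq_zero_or_pos with rfl | hK
    · simp
    · have hK' : (0 : ℝ) < K := by exact_mod_cast hK
      beta_reduce
      rw [Finset.sum_comm, Finset.mul_sum, Finset.mul_sum]
      refine Finset.sum_congr rfl fun c _ => ?_
      rw [← Finset.mul_sum, Finset.sum_sub_distrib]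
      simp only [Finset.sum_const, Finset.card_range, nsmul_eq_mul]
      have h2 : √(K : ℝ) ^ 2 = K := Real.sq_sqrt hK'.le
      have h3 : √(K : ℝ) ≠ 0 := (Real.sqrt_pos.2 hK').ne'
      field_simp
      rw [h2]
      ring
  set b := OneShot.influence β w t m α
  have hae := OneShot.ae_consistent_and_isLittleO_contrast hJ hw ht hβ hα m hindep' hlaw hest
  have hRm : ∀ K : ℕ, AEMeasurable (fun ω => √(K : ℝ) * (m ⬝ᵥ (αhat K ω - α) -
      ∑ c, b c * ((∑ k ∈ Finset.range K, X c k ω) / K - p c))) P := by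
    intro K
    have h1 : Measurable fun a : Fin 2 → ℝ => m ⬝ᵥ (a - α) := by
      unfold dotProduct
      fun_prop
    have h2 := h1.comp_aemeasurable (hmeas K)
    have h3 : AEMeasurable
        (fun ω => ∑ c, b c * ((∑ k ∈ Finset.range K, X c k ω) / K - p c)) P :=
      Finset.aemeasurable_fun_sum _ fun c _ =>
        (((Finset.aemeasurable_fun_sum _ fun k _ => hXm c k).div_const _).sub_const _).const_mul _
    exact (h2.sub h3).const_mul _
  have hR := tendstoInMeasure_zero_of_isLittleO_sum
    (E := fun (c : Fin I × Fin J) (K : ℕ) ω =>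
      √(K : ℝ) * ((∑ k ∈ Finset.range K, X c k ω) / K - p c))
    (Y := fun c x => √(∑ c', (Pi.single c (1 : ℝ) : Fin I × Fin J → ℝ) c' ^ 2 *
      ((p c' : ℝ) * (1 - p c'))) * x)
    (fun c => by simpa [Pi.single_apply] using hclt (Pi.single c 1)) hRm (by
      filter_upwards [hae] with ω hω
      have h1 := (Asymptotics.isBigO_refl (fun K : ℕ => √(K : ℝ)) atTop).mul_isLittleO hω.2
      refine h1.congr_right fun K => ?_
      rw [Finset.mul_sum]
      exact Finset.sum_congr rfl fun c _ => by
        rw [abs_mul, abs_of_nonneg (Real.sqrt_nonneg _)])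
  have hv := OneShot.asympVar_pos β hJ hw ht hm hα
  have hG := hclt b
  have hvar : ∑ c, b c ^ 2 * ((p c : ℝ) * (1 - p c)) = OneShot.asympVar β w t m α :=
    (OneShot.asympVar_eq_sum ht m hα).symm
  rw [hvar] at hG
  have hS : ∀ᵐ ω ∂P, Tendsto (fun K => OneShot.asympVar β w t m (αhat K ω)) atTop
      (nhds (OneShot.asympVar β w t m α)) := by
    filter_upwards [hae] with ω hω
    exact (OneShot.continuousAt_asympVar β hJ hw ht m hα).tendsto.comp hω.1
  refine (tendstoInDistribution_studentized hv hG hR hRm hS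
    (fun K => (OneShot.measurable_asympVar β w t m).comp_aemeasurable (hmeas K))).congr
    (fun K => ae_of_all _ fun ω => ?_) (ae_eq_refl _)
  -- Main term plus remainder is exactly `√K * (m ⬝ᵥ (αhat - α))`, and `d = m ⬝ᵥ α` under the null
  -- hypothesis.
  change _ = √(K / OneShot.asympVar β w t m (αhat K ω)) * (m ⬝ᵥ αhat K ω - d)
  rw [Real.sqrt_div K.cast_nonneg, ← hH, ← dotProduct_sub]
  ring
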